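/- Let $(\Omega,\Sigma,\mathbb P)$ be a nonatomic probability space. Let $\Phi:[0,\infty)\to[0,\infty)$ be an Orlicz function, that is, a convex increasing function with $\Phi(0)=0$, and suppose that $\Phi(t)>0$ for all $t>0$ and $\lim_{t\to\infty}\Phi(t)/t=\infty$. Let $\Psi(s)=\sup\{ts-\Phi(t):t\ge 0\}$, $s\ge 0$, be its conjugate, which is again an Orlicz function. For an Orlicz function $\Theta$, let $L^\Theta$ be the space of real random variables $X$ (modulo a.s. equality) whose Luxemburg norm $$\|X\|_\Theta=\inf\{\lambda>0:\mathbb E[\Theta(|X|/\lambda)]\le 1\}$$ is finite. Let $\sigma(L^\Phi,L^\Psi)$ be the weak topology on $L^\Phi$ induced by the pairing $(X,Y)\mapsto\mathbb E[XY]$, $X\in L^\Phi$, $Y\in L^\Psi$. A sequence $(X_n)$ in $L^\Phi$ order converges to $X\in L^\Phi$ if $X_n\to X$ a.s. and there is $Z\in L^\Phi$ with $|X_n|\le Z$ a.s. for all $n$. For a set $\mathcal C\subset L^\Phi$, the order closure $\overline{\mathcal C}^{o}$ is the set of all $X\in L^\Phi$ to which some sequence in $\mathcal C$ order converges, and $\mathcal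 C$ is order closed if $\mathcal C=\overline{\mathcal C}^{o}$. Theorem. Let $\mathcal C$ be a norm bounded convex set in $L^\Phi$. Then $$\overline{\mathcal C}^{o}=\overline{\mathcal C}^{\sigma(L^\Phi,L^\Psi)}.$$ In particular, $\overline{\mathcal C}^{o}$ is order closed, and $\mathcal C$ is order closed if and only if it is $\sigma(L^\Phi,L^\Psi)$-closed. -/

import Mathlib

open MeasureTheory Filter Topology Set
open scoped ENNReal

/-- A probability space is nonatomic if every event of positive measure contains an event of
strictly smaller positive measure. -/
def IsNonatomic {Ω : Type*} [MeasurableSpace Ω] (P : Measure Ω) : Prop :=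
  ∀ A : Set Ω, MeasurableSet A → 0 < P A →
    ∃ B : Set Ω, MeasurableSet B ∧ B ⊆ A ∧ 0 < P B ∧ P B < P A

/-- Orlicz functions `Φ : [0, ∞) → [0, ∞)`: convex, increasing, `Φ 0 = 0`.  They are represented by
functions on `ℝ` of which only the values on `[0, ∞)` are ever used; these are nonnegative by
monotonicity and `Φ 0 = 0`. -/
structure IsOrliczFunction (Φ : ℝ → ℝ) : Prop where
  convexOn : ConvexOn ℝ (Ici 0) Φ
  monotoneOn : MonotoneOn Φ (Ici 0)
  map_zero : Φ 0 = 0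

/-- The conjugate function `Ψ s = sup {t * s - Φ t : t ≥ 0}` (used for `s ≥ 0`; it is finite there
when `Φ t / t → ∞`, see `bddAbove_orliczConj`). -/
noncomputable def orliczConj (Φ : ℝ → ℝ) (s : ℝ) : ℝ :=
  sSup ((fun t : ℝ => t * s - Φ t) '' Ici 0)

theorem IsOrliczFunction.nonneg {Φ : ℝ → ℝ} (hΦ : IsOrliczFunction Φ) {t : ℝ} (ht : 0 ≤ t) :
    0 ≤ Φ t := by
  have h := hΦ.monotoneOn (mem_Ici.2 le_rfl) (mem_Ici.2 ht) ht
  rwa [hΦ.map_zero] at h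

theorem bddAbove_orliczConj {Φ : ℝ → ℝ} (hΦ : IsOrliczFunction Φ)
    (hlim : Tendsto (fun t : ℝ => Φ t / t) atTop atTop) (s : ℝ) :
    BddAbove ((fun t : ℝ => t * s - Φ t) '' Ici 0) := by
  obtain ⟨T, hT⟩ := (hlim.eventually_ge_atTop s).exists_forall_of_atTop
  refine ⟨|T| * |s|, ?_⟩
  rintro _ ⟨t, ht, rfl⟩
  have ht0 : 0 ≤ t := ht
  have hn := hΦ.nonneg ht0
  have h0 : 0 ≤ |T| * |s| := by positivity
  show t * s - Φ t ≤ |T| * |s|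
  rcases le_or_gt t |T| with h | h
  · have h1 : t * s ≤ t * |s| := mul_le_mul_of_nonneg_left (le_abs_self s) ht0
    have h2 : t * |s| ≤ |T| * |s| := mul_le_mul_of_nonneg_right h (abs_nonneg s)
    linarith
  · have htp : 0 < t := lt_of_le_of_lt (abs_nonneg T) h
    have h1 := hT t ((le_abs_self T).trans h.le)
    rw [le_div_iff₀ htp] at h1
    linarith

/-- Young's inequality. -/
theorem mul_le_add_orliczConj {Φ : ℝ → ℝ} (hΦ : IsOrliczFunction Φ)
    (hlim : Tendsto (fun t : ℝ => Φ t / t) atTop atTop) {t : ℝ} (ht : 0 ≤ t) (s : ℝ) :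
    t * s ≤ Φ t + orliczConj Φ s := by
  have h : t * s - Φ t ≤ orliczConj Φ s :=
    le_csSup (bddAbove_orliczConj hΦ hlim s) ⟨t, ht, rfl⟩
  linarith

/-- The conjugate of an Orlicz function with `Φ t / t → ∞` is an Orlicz function. -/
theorem IsOrliczFunction.conj {Φ : ℝ → ℝ} (hΦ : IsOrliczFunction Φ)
    (hlim : Tendsto (fun t : ℝ => Φ t / t) atTop atTop) : IsOrliczFunction (orliczConj Φ) := by
  have hne : ∀ s : ℝ, ((fun t : ℝ => t * s - Φ t) '' Ici 0).Nonempty :=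
    fun s => ⟨_, 0, mem_Ici.2 le_rfl, rfl⟩
  refine ⟨⟨convex_Ici 0, ?_⟩, ?_, ?_⟩
  · intro x _ y _ a b ha hb hab
    refine csSup_le (hne _) ?_
    rintro _ ⟨t, ht, rfl⟩
    have hx := mul_le_mul_of_nonneg_left (mul_le_add_orliczConj hΦ hlim ht x) ha
    have hy := mul_le_mul_of_nonneg_left (mul_le_add_orliczConj hΦ hlim ht y) hb
    simp only [smul_eq_mul]
    have hb' : b = 1 - a := by linarith
    subst hb'
    nlinarith
  · intro x _ y _ hxy
    refine csSup_le (hne _) ?_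
    rintro _ ⟨t, ht, rfl⟩
    have h1 := mul_le_add_orliczConj hΦ hlim ht y
    have h2 := mul_le_mul_of_nonneg_left hxy (mem_Ici.1 ht)
    show t * x - Φ t ≤ orliczConj Φ y
    linarith
  · refine le_antisymm (csSup_le (hne _) ?_) ?_
    · rintro _ ⟨t, ht, rfl⟩
      have := hΦ.nonneg (mem_Ici.1 ht)
      show t * 0 - Φ t ≤ 0
      linarith
    · have := mul_le_add_orliczConj hΦ hlim (le_refl (0 : ℝ)) 0
      rw [hΦ.map_zero] at this
      linarith

/-- The Luxemburg norm `inf {c > 0 : E[Φ(|X| / c)] ≤ 1}`, with values in `[0, ∞]`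
(`inf ∅ = ∞`). -/
noncomputable def luxemburgNorm {Ω : Type*} [MeasurableSpace Ω] (Φ : ℝ → ℝ) (P : Measure Ω)
    (X : Ω →ₘ[P] ℝ) : ℝ≥0∞ :=
  ⨅ (c : ℝ) (_ : 0 < c) (_ : ∫⁻ ω, ENNReal.ofReal (Φ (|X ω| / c)) ∂P ≤ 1), ENNReal.ofReal c

theorem luxemburgNorm_lt_top_iff {Ω : Type*} [MeasurableSpace Ω] {Φ : ℝ → ℝ} {P : Measure Ω}
    {X : Ω →ₘ[P] ℝ} : luxemburgNorm Φ P X < ∞ ↔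
      ∃ c : ℝ, 0 < c ∧ ∫⁻ ω, ENNReal.ofReal (Φ (|X ω| / c)) ∂P ≤ 1 := by
  simp [luxemburgNorm, iInf_lt_iff]

theorem IsOrliczFunction.aemeasurable_comp {Ω : Type*} [MeasurableSpace Ω] {Φ : ℝ → ℝ}
    (hΦ : IsOrliczFunction Φ) {P : Measure Ω} (X : Ω →ₘ[P] ℝ) {c : ℝ} (hc : 0 < c) :
    AEMeasurable (fun ω => Φ (|X ω| / c)) P := by
  have hg : Monotone (fun x : ℝ => Φ (max x 0)) := fun x y h =>
    hΦ.monotoneOn (mem_Ici.2 (le_max_right _ _)) (mem_Ici.2 (le_max_right _ _))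
      (max_le_max h le_rfl)
  have h2 : Measurable (fun x : ℝ => Φ (max (|x| / c) 0)) :=
    hg.measurable.comp (by fun_prop : Measurable (fun x : ℝ => |x| / c))
  have h3 := h2.comp_aemeasurable X.aestronglyMeasurable.aemeasurable
  refine h3.congr (Eventually.of_forall fun ω => ?_)
  have : 0 ≤ |X ω| / c := by positivity
  simp [max_eq_left this]

/-- The Orlicz space `L^Φ` of (classes modulo a.s. equality of) random variables with finite
Luxemburg norm, as a vector space. -/
noncomputable def orliczSpace {Ω : Type*} [MeasurableSpace Ω] {Φ : ℝ → ℝ}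
    (hΦ : IsOrliczFunction Φ) (P : Measure Ω) : Submodule ℝ (Ω →ₘ[P] ℝ) where
  carrier := {X | luxemburgNorm Φ P X < ∞}
  zero_mem' := by
    refine luxemburgNorm_lt_top_iff.2 ⟨1, one_pos, ?_⟩
    have h : (fun ω => ENNReal.ofReal (Φ (|(0 : Ω →ₘ[P] ℝ) ω| / 1))) =ᵐ[P] fun _ => 0 := by
      filter_upwards [AEEqFun.coeFn_zero (μ := P) (α := Ω) (β := ℝ)] with ω h
      simp [h, hΦ.map_zero]
    rw [lintegral_congr_ae h]
    simp
  add_mem' := by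
    rintro X Y hX hY
    obtain ⟨a, ha, hXa⟩ := luxemburgNorm_lt_top_iff.1 hX
    obtain ⟨b, hb, hYb⟩ := luxemburgNorm_lt_top_iff.1 hY
    refine luxemburgNorm_lt_top_iff.2 ⟨a + b, by positivity, ?_⟩
    have hab : 0 < a + b := by positivity
    have hs : a / (a + b) + b / (a + b) = 1 := by field_simp
    have hle : (fun ω => ENNReal.ofReal (Φ (|(X + Y) ω| / (a + b)))) ≤ᵐ[P] fun ω =>
        ENNReal.ofReal (a / (a + b)) * ENNReal.ofReal (Φ (|X ω| / a)) +
          ENNReal.ofReal (b / (a + b)) * ENNReal.ofReal (Φ (|Y ω| / b)) := by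
      filter_upwards [AEEqFun.coeFn_add X Y] with ω h
      have hxa : 0 ≤ |X ω| / a := by positivity
      have hyb : 0 ≤ |Y ω| / b := by positivity
      have pa : 0 ≤ a / (a + b) := by positivity
      have pb : 0 ≤ b / (a + b) := by positivity
      rw [← ENNReal.ofReal_mul pa, ← ENNReal.ofReal_mul pb,
        ← ENNReal.ofReal_add (mul_nonneg pa (hΦ.nonneg hxa)) (mul_nonneg pb (hΦ.nonneg hyb))]
      refine ENNReal.ofReal_le_ofReal ?_
      have hc := hΦ.convexOn.2 (mem_Ici.2 hxa) (mem_Ici.2 hyb) pa pb hs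
      simp only [smul_eq_mul] at hc
      refine le_trans (hΦ.monotoneOn (mem_Ici.2 (by positivity)) (mem_Ici.2 (by positivity)) ?_) hc
      have e : a / (a + b) * (|X ω| / a) + b / (a + b) * (|Y ω| / b)
          = (|X ω| + |Y ω|) / (a + b) := by field_simp
      rw [e, h]
      exact div_le_div_of_nonneg_right (abs_add_le _ _) hab.le
    refine (lintegral_mono_ae hle).trans ?_
    have m1 := (hΦ.aemeasurable_comp X ha).ennreal_ofReal
    rw [lintegral_add_left' (m1.const_mul _), lintegral_const_mul' _ _ ENNReal.ofReal_ne_top,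
      lintegral_const_mul' _ _ ENNReal.ofReal_ne_top]
    calc _ ≤ ENNReal.ofReal (a / (a + b)) * 1 + ENNReal.ofReal (b / (a + b)) * 1 := by gcongr
      _ = 1 := by
        rw [mul_one, mul_one, ← ENNReal.ofReal_add (by positivity) (by positivity), hs,
          ENNReal.ofReal_one]
  smul_mem' := by
    rintro r X hX
    obtain ⟨a, ha, hXa⟩ := luxemburgNorm_lt_top_iff.1 hX
    refine luxemburgNorm_lt_top_iff.2 ⟨(|r| + 1) * a, by positivity, ?_⟩
    refine le_trans (lintegral_mono_ae ?_) hXa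
    filter_upwards [AEEqFun.coeFn_smul r X] with ω h
    refine ENNReal.ofReal_le_ofReal (hΦ.monotoneOn (mem_Ici.2 (by positivity))
      (mem_Ici.2 (by positivity)) ?_)
    rw [h, Pi.smul_apply, smul_eq_mul, abs_mul, div_le_div_iff₀ (by positivity) ha]
    have : 0 ≤ |X ω| * a := by positivity
    nlinarith

theorem IsOrliczFunction.integrable_comp {Ω : Type*} [MeasurableSpace Ω] {Φ : ℝ → ℝ}
    (hΦ : IsOrliczFunction Φ) {P : Measure Ω} {X : Ω →ₘ[P] ℝ} {c : ℝ} (hc : 0 < c)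
    (h : ∫⁻ ω, ENNReal.ofReal (Φ (|X ω| / c)) ∂P ≤ 1) :
    Integrable (fun ω => Φ (|X ω| / c)) P := by
  refine ⟨(hΦ.aemeasurable_comp X hc).aestronglyMeasurable, ?_⟩
  rw [hasFiniteIntegral_iff_ofReal (Eventually.of_forall fun ω => hΦ.nonneg (by positivity))]
  exact h.trans_lt ENNReal.one_lt_top

/-- Products `X Y` with `X ∈ L^Φ`, `Y ∈ L^Ψ` are integrable, so `E[X Y]` below is meaningful. -/
theorem integrable_mul_orlicz {Ω : Type*} [MeasurableSpace Ω] {Φ : ℝ → ℝ}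
    (hΦ : IsOrliczFunction Φ) (hlim : Tendsto (fun t : ℝ => Φ t / t) atTop atTop)
    {P : Measure Ω} (X : orliczSpace hΦ P) (Y : orliczSpace (hΦ.conj hlim) P) :
    Integrable (fun ω => (X : Ω →ₘ[P] ℝ) ω * (Y : Ω →ₘ[P] ℝ) ω) P := by
  obtain ⟨a, ha, hXa⟩ := luxemburgNorm_lt_top_iff.1 X.2
  obtain ⟨b, hb, hYb⟩ := luxemburgNorm_lt_top_iff.1 Y.2
  have hi := ((hΦ.integrable_comp ha hXa).add
    ((hΦ.conj hlim).integrable_comp hb hYb)).const_mul (a * b)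
  refine hi.mono' ((X : Ω →ₘ[P] ℝ).aestronglyMeasurable.mul
    (Y : Ω →ₘ[P] ℝ).aestronglyMeasurable) (Eventually.of_forall fun ω => ?_)
  have hy := mul_le_add_orliczConj hΦ hlim
    (t := |(X : Ω →ₘ[P] ℝ) ω| / a) (by positivity) (|(Y : Ω →ₘ[P] ℝ) ω| / b)
  have e : ‖(X : Ω →ₘ[P] ℝ) ω * (Y : Ω →ₘ[P] ℝ) ω‖
      = a * b * (|(X : Ω →ₘ[P] ℝ) ω| / a * (|(Y : Ω →ₘ[P] ℝ) ω| / b)) := by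
    rw [Real.norm_eq_abs, abs_mul]; field_simp
  rw [e]
  exact mul_le_mul_of_nonneg_left hy (by positivity)

/-- The duality pairing `(X, Y) ↦ E[X Y]` between `L^Φ` and `L^Ψ`. -/
noncomputable def orliczPairing {Ω : Type*} [MeasurableSpace Ω] {Φ : ℝ → ℝ}
    (hΦ : IsOrliczFunction Φ) (hlim : Tendsto (fun t : ℝ => Φ t / t) atTop atTop)
    (P : Measure Ω) : orliczSpace hΦ P →ₗ[ℝ] orliczSpace (hΦ.conj hlim) P →ₗ[ℝ] ℝ :=
  LinearMap.mk₂ ℝ (fun X Y => ∫ ω, (X : Ω →ₘ[P] ℝ) ω * (Y : Ω →ₘ[P] ℝ) ω ∂P)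
    (fun X X' Y => by
      rw [← integral_add (integrable_mul_orlicz hΦ hlim X Y) (integrable_mul_orlicz hΦ hlim X' Y)]
      refine integral_congr_ae ?_
      filter_upwards [AEEqFun.coeFn_add (X : Ω →ₘ[P] ℝ) (X' : Ω →ₘ[P] ℝ)] with ω h
      simp only [Submodule.coe_add, h, Pi.add_apply]; ring)
    (fun r X Y => by
      rw [smul_eq_mul, ← integral_const_mul]
      refine integral_congr_ae ?_
      filter_upwards [AEEqFun.coeFn_smul r (X : Ω →ₘ[P] ℝ)] with ω h
      simp only [Submodule.coe_smul, h, Pi.smul_apply, smul_eq_mul]; ring)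
    (fun X Y Y' => by
      rw [← integral_add (integrable_mul_orlicz hΦ hlim X Y) (integrable_mul_orlicz hΦ hlim X Y')]
      refine integral_congr_ae ?_
      filter_upwards [AEEqFun.coeFn_add (Y : Ω →ₘ[P] ℝ) (Y' : Ω →ₘ[P] ℝ)] with ω h
      simp only [Submodule.coe_add, h, Pi.add_apply]; ring)
    (fun r X Y => by
      rw [smul_eq_mul, ← integral_const_mul]
      refine integral_congr_ae ?_
      filter_upwards [AEEqFun.coeFn_smul r (Y : Ω →ₘ[P] ℝ)] with ω h
      simp only [Submodule.coe_smul, h, Pi.smul_apply, smul_eq_mul]; ring)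

/-- The topology `σ(L^Φ, L^Ψ)` on `L^Φ`: the weak topology of the duality pairing. -/
noncomputable abbrev orliczWeakTopology {Ω : Type*} [MeasurableSpace Ω] {Φ : ℝ → ℝ}
    (hΦ : IsOrliczFunction Φ) (hlim : Tendsto (fun t : ℝ => Φ t / t) atTop atTop)
    (P : Measure Ω) : TopologicalSpace (orliczSpace hΦ P) :=
  (WeakBilin.instTopologicalSpace (orliczPairing hΦ hlim P) :
    TopologicalSpace (WeakBilin (orliczPairing hΦ hlim P)))

/-- Order convergence of a sequence in `L^Φ`: a.s. convergence together with order boundedness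
in `L^Φ`. -/
def OrderConverges {Ω : Type*} [MeasurableSpace Ω] {Φ : ℝ → ℝ} {hΦ : IsOrliczFunction Φ}
    {P : Measure Ω} (X : ℕ → orliczSpace hΦ P) (L : orliczSpace hΦ P) : Prop :=
  (∀ᵐ ω ∂P, Tendsto (fun n => (X n : Ω →ₘ[P] ℝ) ω) atTop (𝓝 ((L : Ω →ₘ[P] ℝ) ω))) ∧
    ∃ Z : orliczSpace hΦ P, ∀ n, ∀ᵐ ω ∂P, |(X n : Ω →ₘ[P] ℝ) ω| ≤ (Z : Ω →ₘ[P] ℝ) ω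

/-- The order closure of `C`: the set of all order limits in `L^Φ` of sequences in `C`. -/
def orderClosure {Ω : Type*} [MeasurableSpace Ω] {Φ : ℝ → ℝ} {hΦ : IsOrliczFunction Φ}
    {P : Measure Ω} (C : Set (orliczSpace hΦ P)) : Set (orliczSpace hΦ P) :=
  {L | ∃ X : ℕ → orliczSpace hΦ P, (∀ n, X n ∈ C) ∧ OrderConverges X L}

/-- `C` is order closed if it equals its order closure. -/
def IsOrderClosed {Ω : Type*} [MeasurableSpace Ω] {Φ : ℝ → ℝ} {hΦ : IsOrliczFunction Φ}
    {P : Measure Ω} (C : Set (orliczSpace hΦ P)) : Prop :=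
  C = orderClosure C

/-- `C` is bounded in the Luxemburg norm. -/
def IsLuxemburgBounded {Ω : Type*} [MeasurableSpace Ω] {Φ : ℝ → ℝ} {hΦ : IsOrliczFunction Φ}
    {P : Measure Ω} (C : Set (orliczSpace hΦ P)) : Prop :=
  ∃ M : ℝ, ∀ X ∈ C, luxemburgNorm Φ P (X : Ω →ₘ[P] ℝ) ≤ ENNReal.ofReal M

/-! An order convergent sequence converges weakly by dominated convergence, since Young's inequality
makes |Z Y| integrable for an order bound Z ∈ L^Φ and any Y ∈ L^Ψ. So the order closure lies in the
weak closure.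

For the converse, let L be in the weak closure of C. Norm boundedness gives one scale a at which
every X - L, X ∈ C, has finite modular. The key claim is that E[Φ(|X - L| / 2a)] can be made
arbitrarily small over X ∈ C. If it stayed above ε, then C - L would miss the ball {modular at scale
2a ≤ ε}, which is convex, balanced and absorbent, and Hahn-Banach would give a functional f with f ≤
u on the ball and f ≥ u > 0 on C - L. Such an f need not come from L^Ψ: it may have a part invisible
on bounded functions. On bounded functions it is integration against a density y (Radon-Nikodym),
and y ∈ L^Ψ by testing on near-maximizers in the definition of Ψ. The factor 2 in the scale controls
the invisible part: if Z has finite modular at scale a, twice its tail beyond a high truncation lies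
in the ball, so f of the tail is at most u/2. Hence E[Z y] ≥ u/2 for all Z ∈ C - L, contradicting
weak adherence (`exists_pairing_ge_of_forall_lt_orliczModular`).

Elements X_n ∈ C with modulars at most 2^(-n) then order converge to L, as their summed modulars
dominate both the pointwise errors and their supremum
(`orderConverges_of_tsum_orliczModular_lt_top`). -/

/-! ### Algebraic separation from an absorbent set. -/

/-- The gauge of B is a seminorm whose open unit ball lies in B, so geometric Hahn-Banach applies in
the topology of that seminorm; no prior topology on V is needed. -/
theorem exists_linearMap_separating_of_absorbent {V : Type*} [AddCommGroup V] [Module ℝ V]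
    {B D : Set V} (hbal : Balanced ℝ B) (hconv : Convex ℝ B) (habs : Absorbent ℝ B)
    (hD : Convex ℝ D) (hdisj : Disjoint B D) :
    ∃ (f : V →ₗ[ℝ] ℝ) (u : ℝ), 0 < u ∧ (∀ x ∈ B, f x ≤ u) ∧ ∀ x ∈ D, u ≤ f x := by
  have h0 : (0 : V) ∈ B := by
    simpa using (absorbent_iff_inv_smul.1 habs 0).exists.choose_spec
  let p : Seminorm ℝ V := gaugeSeminorm hbal hconv habs
  let : SeminormedAddCommGroup V := p.toAddGroupSeminorm.toSeminormedAddCommGroup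
  let : NormedSpace ℝ V := { norm_smul_le := fun a b => (map_smul_eq_mul p a b).le }
  have hnorm : ∀ x : V, ‖x‖ = gauge B x := fun x => rfl
  have hsub : Metric.ball (0 : V) 1 ⊆ B := by
    intro x hx
    rw [mem_ball_zero_iff, hnorm] at hx
    exact setOfPred_gauge_lt_one_subset_self hconv h0 habs hx
  obtain ⟨f, u, hf, hu⟩ := geometric_hahn_banach_open (convex_ball (0 : V) 1) Metric.isOpen_ball hD
    (hdisj.mono_left hsub)
  have hupos : 0 < u := by simpa using hf 0 (Metric.mem_ball_self one_pos)
  refine ⟨f.toLinearMap, u, hupos, fun x hx => ?_, hu⟩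
  have hx1 : ‖x‖ ≤ 1 := gauge_le_one_of_mem hx
  -- A point of B may have gauge exactly 1 and miss the open ball; its multiples by t < 1 do not,
  -- and t → 1 gives f x ≤ u.
  have key : ∀ t : ℝ, 0 < t → t < 1 → t * f x < u := by
    intro t ht ht1
    have := hf (t • x) (by
      rw [mem_ball_zero_iff, norm_smul, Real.norm_of_nonneg ht.le]
      nlinarith [norm_nonneg x])
    simpa using this
  by_contra hcon
  have hcon : u < f x := not_le.1 hcon
  have hfx : 0 < f x := hupos.trans hcon
  have := key (u / f x) (div_pos hupos hfx) ((div_lt_one hfx).2 hcon)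
  rw [div_mul_cancel₀ _ hfx.ne'] at this
  exact lt_irrefl _ this

/-! ### Elementary properties of Orlicz functions. -/

namespace IsOrliczFunction

variable {Φ : ℝ → ℝ}

theorem mono (hΦ : IsOrliczFunction Φ) {s t : ℝ} (hs : 0 ≤ s) (hst : s ≤ t) : Φ s ≤ Φ t :=
  hΦ.monotoneOn (mem_Ici.2 hs) (mem_Ici.2 (hs.trans hst)) hst

/-- Convexity on the segment from 0 to t, together with Φ 0 = 0. -/
theorem map_mul_le (hΦ : IsOrliczFunction Φ) {r t : ℝ} (hr : 0 ≤ r) (hr1 : r ≤ 1) (ht : 0 ≤ t) :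
    Φ (r * t) ≤ r * Φ t := by
  have h := hΦ.convexOn.2 (mem_Ici.2 ht) (mem_Ici.2 le_rfl) hr (sub_nonneg.2 hr1) (by ring)
  simpa [hΦ.map_zero] using h

theorem tendsto_map_zero (hΦ : IsOrliczFunction Φ) : Tendsto Φ (𝓝[≥] 0) (𝓝 0) := by
  have h1 : Tendsto (fun t : ℝ => t * Φ 1) (𝓝[≥] 0) (𝓝 0) := by
    have : Tendsto (fun t : ℝ => t * Φ 1) (𝓝 0) (𝓝 (0 * Φ 1)) :=
      tendsto_id.mul_const _
    rw [zero_mul] at this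
    exact this.mono_left nhdsWithin_le_nhds
  refine tendsto_of_tendsto_of_tendsto_of_le_of_le' tendsto_const_nhds h1 ?_ ?_
  · filter_upwards [self_mem_nhdsWithin] with t ht using hΦ.nonneg ht
  · have : Iic (1 : ℝ) ∈ 𝓝[≥] (0 : ℝ) := mem_nhdsWithin_of_mem_nhds (Iic_mem_nhds one_pos)
    filter_upwards [self_mem_nhdsWithin, this] with t ht ht1
    simpa using hΦ.map_mul_le ht ht1 zero_le_one

theorem measurable_comp_max (hΦ : IsOrliczFunction Φ) :
    Measurable (fun x : ℝ => Φ (max x 0)) := by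
  have hg : Monotone (fun x : ℝ => Φ (max x 0)) := fun x y h =>
    hΦ.mono (le_max_right _ _) (max_le_max h le_rfl)
  exact hg.measurable

theorem aemeasurable_comp_abs_div {Ω : Type*} [MeasurableSpace Ω] {P : Measure Ω}
    (hΦ : IsOrliczFunction Φ) {g : Ω → ℝ} (hg : AEMeasurable g P) {c : ℝ} (hc : 0 < c) :
    AEMeasurable (fun ω => Φ (|g ω| / c)) P := by
  have h2 : Measurable (fun x : ℝ => Φ (max (|x| / c) 0)) :=
    hΦ.measurable_comp_max.comp (by fun_prop : Measurable (fun x : ℝ => |x| / c))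
  refine (h2.comp_aemeasurable hg).congr (Eventually.of_forall fun ω => ?_)
  have : 0 ≤ |g ω| / c := by positivity
  simp [max_eq_left this]

end IsOrliczFunction

/-! ### Calculus of the modular. -/

/-- The modular `E[Φ(|g| / c)]`. -/
noncomputable def orliczModular {Ω : Type*} [MeasurableSpace Ω] (Φ : ℝ → ℝ) (P : Measure Ω)
    (c : ℝ) (g : Ω → ℝ) : ℝ≥0∞ :=
  ∫⁻ ω, ENNReal.ofReal (Φ (|g ω| / c)) ∂P

section Modular

variable {Ω : Type*} [MeasurableSpace Ω] {P : Measure Ω} {Φ : ℝ → ℝ}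

theorem orliczModular_congr {c : ℝ} {g h : Ω → ℝ} (hgh : g =ᵐ[P] h) :
    orliczModular Φ P c g = orliczModular Φ P c h :=
  lintegral_congr_ae (hgh.mono fun ω e => by simp only [e])

theorem orliczModular_mono (hΦ : IsOrliczFunction Φ) {c : ℝ} (hc : 0 < c) {g h : Ω → ℝ}
    (hgh : ∀ᵐ ω ∂P, |g ω| ≤ |h ω|) : orliczModular Φ P c g ≤ orliczModular Φ P c h :=
  lintegral_mono_ae (hgh.mono fun ω e => ENNReal.ofReal_le_ofReal
    (hΦ.mono (by positivity) (by gcongr)))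

theorem orliczModular_smul_le (hΦ : IsOrliczFunction Φ) {c : ℝ} (hc : 0 < c) {r : ℝ} (hr : 0 ≤ r)
    (hr1 : r ≤ 1) (g : Ω → ℝ) :
    orliczModular Φ P c (fun ω => r * g ω) ≤ ENNReal.ofReal r * orliczModular Φ P c g := by
  unfold orliczModular
  rw [← lintegral_const_mul' _ _ ENNReal.ofReal_ne_top]
  refine lintegral_mono fun ω => ?_
  rw [← ENNReal.ofReal_mul hr]
  refine ENNReal.ofReal_le_ofReal ?_
  rw [abs_mul, abs_of_nonneg hr, mul_div_assoc]
  exact hΦ.map_mul_le hr hr1 (by positivity)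

theorem orliczModular_mul (c r : ℝ) (hr : 0 < r) (g : Ω → ℝ) :
    orliczModular Φ P (r * c) (fun ω => r * g ω) = orliczModular Φ P c g := by
  unfold orliczModular
  refine lintegral_congr fun ω => ?_
  rw [abs_mul, abs_of_pos hr, mul_div_mul_left _ _ hr.ne']

theorem exists_orliczModular_smul_le (hΦ : IsOrliczFunction Φ) {c : ℝ} (hc : 0 < c) {g : Ω → ℝ}
    (hg : orliczModular Φ P c g < ∞) {ε : ℝ≥0∞} (hε : ε ≠ 0) :
    ∃ r : ℝ, 0 < r ∧ orliczModular Φ P c (fun ω => r * g ω) ≤ ε := by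
  have h1 : Tendsto (fun r : ℝ => ENNReal.ofReal r * orliczModular Φ P c g) (𝓝[>] 0)
      (𝓝 0) := by
    have h2 : Tendsto (fun r : ℝ => ENNReal.ofReal r) (𝓝 0) (𝓝 0) := by
      simpa using (ENNReal.continuous_ofReal.tendsto 0)
    simpa using (ENNReal.Tendsto.mul_const (h2.mono_left nhdsWithin_le_nhds) (Or.inr hg.ne) :
      Tendsto (fun r : ℝ => ENNReal.ofReal r * orliczModular Φ P c g) (𝓝[>] 0) _)
  have h3 : Iio (1 : ℝ) ∈ 𝓝[>] (0 : ℝ) := mem_nhdsWithin_of_mem_nhds (Iio_mem_nhds one_pos)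
  obtain ⟨r, hr, hr1, hr0⟩ := ((h1.eventually (gt_mem_nhds (pos_iff_ne_zero.2 hε))).and
    ((eventually_mem_set.2 h3).and self_mem_nhdsWithin)).exists
  exact ⟨r, hr0, (orliczModular_smul_le hΦ hc (le_of_lt hr0) (le_of_lt hr1) g).trans hr.le⟩

/-- Shrinking by r multiplies the modular by at most r, so a finite modular drops to at most 1 at
the larger scale c / r. -/
theorem luxemburgNorm_lt_top_of_orliczModular_lt_top (hΦ : IsOrliczFunction Φ) {c : ℝ}
    (hc : 0 < c) {X : Ω →ₘ[P] ℝ} (h : orliczModular Φ P c X < ∞) : luxemburgNorm Φ P X < ∞ := by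
  obtain ⟨r, hr, hr1⟩ := exists_orliczModular_smul_le hΦ hc h one_ne_zero
  refine luxemburgNorm_lt_top_iff.2 ⟨c / r, by positivity, ?_⟩
  have e := orliczModular_mul (Φ := Φ) (P := P) (c / r) r hr X
  rw [mul_div_cancel₀ _ hr.ne'] at e
  rw [e] at hr1
  exact hr1

theorem exists_orliczModular_le_one {hΦ : IsOrliczFunction Φ} (X : orliczSpace hΦ P) :
    ∃ c : ℝ, 0 < c ∧ orliczModular Φ P c (X : Ω →ₘ[P] ℝ) ≤ 1 :=
  luxemburgNorm_lt_top_iff.1 X.2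

theorem orliczModular_lt_top_of_bounded [IsFiniteMeasure P] (hΦ : IsOrliczFunction Φ) {c : ℝ}
    (hc : 0 < c) {g : Ω → ℝ} {k : ℝ} (hk : ∀ᵐ ω ∂P, |g ω| ≤ k) : orliczModular Φ P c g < ∞ := by
  have : orliczModular Φ P c g ≤ ∫⁻ _, ENNReal.ofReal (Φ (k / c)) ∂P :=
    lintegral_mono_ae (hk.mono fun ω h => ENNReal.ofReal_le_ofReal
      (hΦ.mono (by positivity) (by gcongr)))
  refine this.trans_lt ?_
  rw [lintegral_const]
  exact ENNReal.mul_lt_top ENNReal.ofReal_lt_top (measure_lt_top _ _)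

theorem antitone_orliczModular (hΦ : IsOrliczFunction Φ) {c d : ℝ} (hc : 0 < c) (hcd : c ≤ d)
    (g : Ω → ℝ) : orliczModular Φ P d g ≤ orliczModular Φ P c g :=
  lintegral_mono fun ω => ENNReal.ofReal_le_ofReal (hΦ.mono (by have := hc.trans_le hcd; positivity)
    (by gcongr))

/-- Convexity of the modular. -/
theorem orliczModular_convexComb_le (hΦ : IsOrliczFunction Φ) {c : ℝ} (hc : 0 < c) {g h : Ω → ℝ}
    (hg : AEMeasurable g P) {r s : ℝ} (hr : 0 ≤ r) (hs : 0 ≤ s) (hrs : r + s = 1) :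
    orliczModular Φ P c (fun ω => r * g ω + s * h ω) ≤
      ENNReal.ofReal r * orliczModular Φ P c g + ENNReal.ofReal s * orliczModular Φ P c h := by
  unfold orliczModular
  rw [← lintegral_const_mul' _ _ ENNReal.ofReal_ne_top,
    ← lintegral_const_mul' _ _ ENNReal.ofReal_ne_top,
    ← lintegral_add_left' ((hΦ.aemeasurable_comp_abs_div hg hc).ennreal_ofReal.const_mul _)]
  refine lintegral_mono fun ω => ?_
  have hx : 0 ≤ |g ω| / c := by positivity
  have hy : 0 ≤ |h ω| / c := by positivity
  rw [← ENNReal.ofReal_mul hr, ← ENNReal.ofReal_mul hs,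
    ← ENNReal.ofReal_add (mul_nonneg hr (hΦ.nonneg hx)) (mul_nonneg hs (hΦ.nonneg hy))]
  refine ENNReal.ofReal_le_ofReal ?_
  refine le_trans (hΦ.mono (by positivity) ?_)
    (hΦ.convexOn.2 (mem_Ici.2 hx) (mem_Ici.2 hy) hr hs hrs)
  rw [smul_eq_mul, smul_eq_mul, ← mul_div_assoc, ← mul_div_assoc, ← add_div]
  gcongr
  refine (abs_add_le _ _).trans ?_
  rw [abs_mul, abs_mul, abs_of_nonneg hr, abs_of_nonneg hs]

/-- Dominated convergence to zero of the modular. -/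
theorem tendsto_orliczModular_zero (hΦ : IsOrliczFunction Φ) {ι : Type*} {l : Filter ι}
    [l.IsCountablyGenerated] {c : ℝ} (hc : 0 < c) {g : ι → Ω → ℝ} {b : Ω → ℝ}
    (hg : ∀ i, AEMeasurable (g i) P) (hb : orliczModular Φ P c b < ∞)
    (hgb : ∀ i, ∀ᵐ ω ∂P, |g i ω| ≤ |b ω|) (hlim : ∀ᵐ ω ∂P, Tendsto (fun i => g i ω) l (𝓝 0)) :
    Tendsto (fun i => orliczModular Φ P c (g i)) l (𝓝 0) := by
  have hae : ∀ i, AEMeasurable (fun ω => ENNReal.ofReal (Φ (|g i ω| / c))) P := fun i =>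
    (hΦ.aemeasurable_comp_abs_div (hg i) hc).ennreal_ofReal
  -- Countable generation reduces the limit to sequences. General filters are allowed because finite
  -- subsets of ℕ serve as the index in the proof of countable additivity.
  rw [tendsto_iff_seq_tendsto]
  intro x hx
  have h0 : (0 : ℝ≥0∞) = ∫⁻ _, 0 ∂P := by simp
  rw [h0]
  refine tendsto_lintegral_of_dominated_convergence'
    (fun ω => ENNReal.ofReal (Φ (|b ω| / c))) (fun n => hae (x n)) (fun n => ?_) hb.ne ?_
  · filter_upwards [hgb (x n)] with ω h
    exact ENNReal.ofReal_le_ofReal (hΦ.mono (by positivity) (by gcongr))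
  · filter_upwards [hlim] with ω h
    have h1 : Tendsto (fun n => |g (x n) ω| / c) atTop (𝓝[≥] 0) := by
      refine tendsto_nhdsWithin_iff.2 ⟨?_, Eventually.of_forall fun n => ?_⟩
      · simpa using ((h.comp hx).abs.div_const c)
      · exact mem_Ici.2 (by positivity)
    have := (ENNReal.continuous_ofReal.tendsto 0).comp (hΦ.tendsto_map_zero.comp h1)
    rwa [ENNReal.ofReal_zero] at this

end Modular

/-! ### Representatives in L^Φ and modular balls. -/

section OrliczClass

variable {Ω : Type*} [MeasurableSpace Ω] {P : Measure Ω} {Φ : ℝ → ℝ}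

open Classical in
/-- The element of `L^Φ` represented by a function, or `0` if there is none. -/
noncomputable def orliczClass (hΦ : IsOrliczFunction Φ) (P : Measure Ω) (g : Ω → ℝ) :
    orliczSpace hΦ P :=
  if h : ∃ hg : AEStronglyMeasurable g P, AEEqFun.mk g hg ∈ orliczSpace hΦ P then
    ⟨AEEqFun.mk g h.choose, h.choose_spec⟩ else 0

theorem coeFn_orliczClass (hΦ : IsOrliczFunction Φ) {g : Ω → ℝ} (hg : AEStronglyMeasurable g P)
    {c : ℝ} (hc : 0 < c) (h : orliczModular Φ P c g < ∞) :
    ((orliczClass hΦ P g : orliczSpace hΦ P) : Ω →ₘ[P] ℝ) =ᵐ[P] g := by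
  have hex : ∃ hg : AEStronglyMeasurable g P, AEEqFun.mk g hg ∈ orliczSpace hΦ P := by
    refine ⟨hg, luxemburgNorm_lt_top_of_orliczModular_lt_top hΦ hc ?_⟩
    rwa [orliczModular_congr (AEEqFun.coeFn_mk g hg)]
  rw [orliczClass, dif_pos hex]
  exact AEEqFun.coeFn_mk g hex.choose

theorem coeFn_orliczClass_of_bounded [IsFiniteMeasure P] (hΦ : IsOrliczFunction Φ) {g : Ω → ℝ}
    (hg : AEStronglyMeasurable g P) {k : ℝ} (hk : ∀ᵐ ω ∂P, |g ω| ≤ k) :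
    ((orliczClass hΦ P g : orliczSpace hΦ P) : Ω →ₘ[P] ℝ) =ᵐ[P] g :=
  coeFn_orliczClass hΦ hg one_pos (orliczModular_lt_top_of_bounded hΦ one_pos hk)

theorem orliczSpace_ext {hΦ : IsOrliczFunction Φ} {X Y : orliczSpace hΦ P}
    (h : (X : Ω →ₘ[P] ℝ) =ᵐ[P] (Y : Ω →ₘ[P] ℝ)) : X = Y :=
  Subtype.ext (AEEqFun.ext h)

theorem coeFn_orliczSpace_add {hΦ : IsOrliczFunction Φ} (X Y : orliczSpace hΦ P) :
    ((X + Y : orliczSpace hΦ P) : Ω →ₘ[P] ℝ) =ᵐ[P]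
      fun ω => (X : Ω →ₘ[P] ℝ) ω + (Y : Ω →ₘ[P] ℝ) ω :=
  AEEqFun.coeFn_add _ _

theorem coeFn_orliczSpace_sub {hΦ : IsOrliczFunction Φ} (X Y : orliczSpace hΦ P) :
    ((X - Y : orliczSpace hΦ P) : Ω →ₘ[P] ℝ) =ᵐ[P]
      fun ω => (X : Ω →ₘ[P] ℝ) ω - (Y : Ω →ₘ[P] ℝ) ω :=
  AEEqFun.coeFn_sub _ _

theorem coeFn_orliczSpace_smul {hΦ : IsOrliczFunction Φ} (r : ℝ) (X : orliczSpace hΦ P) :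
    ((r • X : orliczSpace hΦ P) : Ω →ₘ[P] ℝ) =ᵐ[P] fun ω => r * (X : Ω →ₘ[P] ℝ) ω :=
  AEEqFun.coeFn_smul _ _

theorem coeFn_orliczSpace_zero {hΦ : IsOrliczFunction Φ} :
    ((0 : orliczSpace hΦ P) : Ω →ₘ[P] ℝ) =ᵐ[P] fun _ => 0 :=
  AEEqFun.coeFn_zero

/-- The modular balls of `L^Φ`. -/
def orliczModularBall (hΦ : IsOrliczFunction Φ) (P : Measure Ω) (c : ℝ) (ε : ℝ≥0∞) :
    Set (orliczSpace hΦ P) :=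
  {X | orliczModular Φ P c (X : Ω →ₘ[P] ℝ) ≤ ε}

theorem convex_orliczModularBall (hΦ : IsOrliczFunction Φ) {c : ℝ} (hc : 0 < c) (ε : ℝ≥0∞) :
    Convex ℝ (orliczModularBall hΦ P c ε) := by
  intro X hX Y hY r s hr hs hrs
  have e : ((r • X + s • Y : orliczSpace hΦ P) : Ω →ₘ[P] ℝ) =ᵐ[P]
      fun ω => r * (X : Ω →ₘ[P] ℝ) ω + s * (Y : Ω →ₘ[P] ℝ) ω := by
    filter_upwards [coeFn_orliczSpace_add (r • X) (s • Y), coeFn_orliczSpace_smul r X,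
      coeFn_orliczSpace_smul s Y] with ω h1 h2 h3
    rw [h1, h2, h3]
  show orliczModular Φ P c _ ≤ ε
  rw [orliczModular_congr e]
  refine (orliczModular_convexComb_le hΦ hc (X : Ω →ₘ[P] ℝ).aestronglyMeasurable.aemeasurable
    hr hs hrs).trans ?_
  calc _ ≤ ENNReal.ofReal r * ε + ENNReal.ofReal s * ε := by
        gcongr
        · exact hX
        · exact hY
    _ = ε := by
      rw [← add_mul, ← ENNReal.ofReal_add hr hs, hrs, ENNReal.ofReal_one, one_mul]

theorem smul_mem_orliczModularBall {hΦ : IsOrliczFunction Φ} {c : ℝ} (hc : 0 < c) {ε : ℝ≥0∞}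
    {X : orliczSpace hΦ P} {r s : ℝ} (hrs : |r| ≤ |s|) (h : s • X ∈ orliczModularBall hΦ P c ε) :
    r • X ∈ orliczModularBall hΦ P c ε := by
  refine le_trans (orliczModular_mono hΦ hc ?_) h
  filter_upwards [coeFn_orliczSpace_smul r X, coeFn_orliczSpace_smul s X] with ω h1 h2
  rw [h1, h2, abs_mul, abs_mul]
  gcongr

theorem balanced_orliczModularBall (hΦ : IsOrliczFunction Φ) {c : ℝ} (hc : 0 < c) (ε : ℝ≥0∞) :
    Balanced ℝ (orliczModularBall hΦ P c ε) := by
  rintro r hr _ ⟨X, hX, rfl⟩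
  exact smul_mem_orliczModularBall hc (s := 1) (by simpa using hr) (by simpa using hX)

/-- Each X has modular at most 1 at some scale a; rescaling by c / a moves this to scale c, and a
further small factor brings the modular below ε. -/
theorem absorbent_orliczModularBall (hΦ : IsOrliczFunction Φ) {c : ℝ} (hc : 0 < c) {ε : ℝ≥0∞}
    (hε : ε ≠ 0) : Absorbent ℝ (orliczModularBall hΦ P c ε) := by
  refine absorbent_iff_inv_smul.2 fun X => ?_
  obtain ⟨a, ha, haX⟩ := exists_orliczModular_le_one X
  have h1 : orliczModular Φ P c (fun ω => (c / a) * (X : Ω →ₘ[P] ℝ) ω) < ∞ := by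
    have e := orliczModular_mul (Φ := Φ) (P := P) a (c / a) (by positivity) (X : Ω →ₘ[P] ℝ)
    rw [div_mul_cancel₀ _ ha.ne'] at e
    rw [e]
    exact haX.trans_lt ENNReal.one_lt_top
  obtain ⟨r, hr, hrX⟩ := exists_orliczModular_smul_le hΦ hc h1 hε
  have h2 : (r * (c / a)) • X ∈ orliczModularBall hΦ P c ε := by
    refine le_trans (le_of_eq (orliczModular_congr ?_)) hrX
    filter_upwards [coeFn_orliczSpace_smul (r * (c / a)) X] with ω h
    rw [h, mul_assoc]
  have hpos : 0 < r * (c / a) := by positivity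
  filter_upwards [tendsto_norm_cobounded_atTop.eventually_ge_atTop (r * (c / a))⁻¹] with t ht
  refine smul_mem_orliczModularBall hc ?_ h2
  rw [abs_inv, abs_of_pos hpos]
  exact inv_le_of_inv_le₀ hpos ht

end OrliczClass

/-! ### The density of a functional bounded on a modular ball. -/

section Density

variable {Ω : Type*} [MeasurableSpace Ω] {P : Measure Ω} {Φ : ℝ → ℝ}

theorem coeFn_orliczSpace_sum {hΦ : IsOrliczFunction Φ} {ι : Type*} (s : Finset ι)
    (X : ι → orliczSpace hΦ P) :
    ((∑ i ∈ s, X i : orliczSpace hΦ P) : Ω →ₘ[P] ℝ) =ᵐ[P]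
      fun ω => ∑ i ∈ s, (X i : Ω →ₘ[P] ℝ) ω := by
  classical
  induction s using Finset.induction_on with
  | empty => simpa using coeFn_orliczSpace_zero (P := P) (hΦ := hΦ)
  | insert a s ha ih =>
    rw [Finset.sum_insert ha]
    filter_upwards [coeFn_orliczSpace_add (X a) (∑ i ∈ s, X i), ih] with ω h1 h2
    rw [h1, h2, Finset.sum_insert ha]

/-- A linear functional bounded above on a modular ball is continuous under bounded a.s.
convergence. -/
theorem tendsto_of_bounded_of_le_on_modularBall [IsFiniteMeasure P] {hΦ : IsOrliczFunction Φ}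
    {c : ℝ} (hc : 0 < c) {ε : ℝ≥0∞} (hε : ε ≠ 0) {f : orliczSpace hΦ P →ₗ[ℝ] ℝ} {u : ℝ}
    (hf : ∀ X ∈ orliczModularBall hΦ P c ε, f X ≤ u) {ι : Type*} {l : Filter ι}
    [l.IsCountablyGenerated] {Z : ι → orliczSpace hΦ P} {k : ℝ}
    (hk : ∀ i, ∀ᵐ ω ∂P, |(Z i : Ω →ₘ[P] ℝ) ω| ≤ k)
    (hlim : ∀ᵐ ω ∂P, Tendsto (fun i => (Z i : Ω →ₘ[P] ℝ) ω) l (𝓝 0)) :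
    Tendsto (fun i => f (Z i)) l (𝓝 0) := by
  rw [Metric.tendsto_nhds]
  intro δ hδ
  -- Once ±K • Z i lie in the ball, K |f (Z i)| ≤ u < |u| + 1 = K δ.
  set K : ℝ := (|u| + 1) / δ with hK
  have hKpos : 0 < K := by positivity
  have h1 : Tendsto (fun i => orliczModular Φ P c (fun ω => K * (Z i : Ω →ₘ[P] ℝ) ω)) l (𝓝 0) := by
    refine tendsto_orliczModular_zero hΦ hc (b := fun _ => K * k)
      (fun i => (Z i : Ω →ₘ[P] ℝ).aestronglyMeasurable.aemeasurable.const_mul K)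
      (orliczModular_lt_top_of_bounded hΦ hc (Eventually.of_forall fun _ => le_rfl)) (fun i => ?_) ?_
    · filter_upwards [hk i] with ω h
      rw [abs_mul, abs_mul]
      exact mul_le_mul_of_nonneg_left (h.trans (le_abs_self k)) (abs_nonneg K)
    · filter_upwards [hlim] with ω h
      simpa using h.const_mul K
  filter_upwards [h1.eventually (gt_mem_nhds (pos_iff_ne_zero.2 hε))] with i hi
  have h2 : K • Z i ∈ orliczModularBall hΦ P c ε :=
    (orliczModular_congr (coeFn_orliczSpace_smul K (Z i))).le.trans hi.le
  have h3 : (-K) • Z i ∈ orliczModularBall hΦ P c ε :=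
    smul_mem_orliczModularBall hc (by rw [abs_neg]) h2
  have h4 := hf _ h2
  have h5 := hf _ h3
  rw [map_smul, smul_eq_mul] at h4 h5
  have h6 : K * |f (Z i)| ≤ u := by
    rcases abs_cases (f (Z i)) with ⟨h, _⟩ | ⟨h, _⟩ <;> rw [h] <;> linarith
  rw [Real.dist_eq, sub_zero]
  have h7 : K * |f (Z i)| < K * δ := by
    rw [hK, div_mul_cancel₀ _ hδ.ne', ← hK]
    linarith [le_abs_self u]
  exact lt_of_mul_lt_mul_left h7 hKpos.le

theorem abs_indicator_one_le {α : Type*} (A : Set α) (x : α) :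
    |A.indicator (fun _ => (1 : ℝ)) x| ≤ 1 := by
  by_cases h : x ∈ A <;> simp [h]

theorem hasSum_indicator_iUnion_of_disjoint {α : Type*} {A : ℕ → Set α}
    (hA : Pairwise (Function.onFun Disjoint A)) (x : α) :
    HasSum (fun i => (A i).indicator (fun _ => (1 : ℝ)) x)
      ((⋃ i, A i).indicator (fun _ => (1 : ℝ)) x) := by
  by_cases hx : x ∈ ⋃ i, A i
  · obtain ⟨j, hj⟩ := mem_iUnion.1 hx
    have h := hasSum_single (f := fun i => (A i).indicator (fun _ => (1 : ℝ)) x) j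
      (fun i hi => indicator_of_notMem (fun hxi => (hA hi).le_bot ⟨hxi, hj⟩) _)
    simpa [hx, hj] using h
  · have h : ∀ i, x ∉ A i := fun i hi => hx (mem_iUnion.2 ⟨i, hi⟩)
    simp [hx, h]

theorem coeFn_orliczClass_indicator [IsFiniteMeasure P] (hΦ : IsOrliczFunction Φ) {A : Set Ω}
    (hA : MeasurableSet A) :
    ((orliczClass hΦ P (A.indicator fun _ => (1 : ℝ)) : orliczSpace hΦ P) : Ω →ₘ[P] ℝ) =ᵐ[P]
      A.indicator fun _ => (1 : ℝ) :=
  coeFn_orliczClass_of_bounded hΦ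
    (measurable_const.indicator hA).aestronglyMeasurable
    (Eventually.of_forall (abs_indicator_one_le A))

open Classical in
/-- The signed measure `A ↦ f(1_A)` of a linear functional bounded above on a modular ball. -/
noncomputable def orliczSignedMeasure [IsFiniteMeasure P] {hΦ : IsOrliczFunction Φ}
    {c : ℝ} (hc : 0 < c) {ε : ℝ≥0∞} (hε : ε ≠ 0) {f : orliczSpace hΦ P →ₗ[ℝ] ℝ} {u : ℝ}
    (hf : ∀ X ∈ orliczModularBall hΦ P c ε, f X ≤ u) : SignedMeasure Ω where
  measureOf' A := if MeasurableSet A then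
    f (orliczClass hΦ P (A.indicator fun _ => (1 : ℝ))) else 0
  empty' := by
    rw [if_pos MeasurableSet.empty]
    have : orliczClass hΦ P ((∅ : Set Ω).indicator fun _ => (1 : ℝ)) = 0 := by
      refine orliczSpace_ext ?_
      filter_upwards [coeFn_orliczClass_indicator (P := P) hΦ MeasurableSet.empty,
        coeFn_orliczSpace_zero (P := P) (hΦ := hΦ)] with ω h1 h2
      rw [h1, h2]; simp
    rw [this, map_zero]
  not_measurable' A hA := if_neg hA
  m_iUnion' A hA hdisj := by
    have hU : MeasurableSet (⋃ i, A i) := MeasurableSet.iUnion hA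
    simp only [hA, hU, if_true]
    set U : orliczSpace hΦ P := orliczClass hΦ P ((⋃ i, A i).indicator fun _ => (1 : ℝ)) with hUdef
    set T : ℕ → orliczSpace hΦ P := fun i => orliczClass hΦ P ((A i).indicator fun _ => (1 : ℝ))
      with hT
    have hae : ∀ s : Finset ℕ, ((U - ∑ i ∈ s, T i : orliczSpace hΦ P) : Ω →ₘ[P] ℝ) =ᵐ[P]
        fun ω => (⋃ i, A i).indicator (fun _ => (1 : ℝ)) ω -
          ∑ i ∈ s, (A i).indicator (fun _ => (1 : ℝ)) ω := by
      intro s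
      have h3 : ∀ᵐ ω ∂P, ∀ i, (T i : Ω →ₘ[P] ℝ) ω = (A i).indicator (fun _ => (1 : ℝ)) ω :=
        ae_all_iff.2 fun i => coeFn_orliczClass_indicator hΦ (hA i)
      filter_upwards [coeFn_orliczSpace_sub U (∑ i ∈ s, T i), coeFn_orliczSpace_sum s T, h3,
        coeFn_orliczClass_indicator (P := P) hΦ hU] with ω h1 h2 h3 h4
      rw [h1, h2, h4]
      simp only [h3]
    -- Countable additivity: the remainders are indicators of what is left of the union, hence
    -- bounded by 1 and pointwise convergent to 0.
    have hlim : Tendsto (fun s : Finset ℕ => f (U - ∑ i ∈ s, T i)) atTop (𝓝 0) := by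
      refine tendsto_of_bounded_of_le_on_modularBall hc hε hf (k := 1) (fun s => ?_) ?_
      · filter_upwards [hae s] with ω h
        rw [h]
        have h1 := hasSum_indicator_iUnion_of_disjoint hdisj ω
        have hnn : ∀ i, 0 ≤ (A i).indicator (fun _ => (1 : ℝ)) ω := fun i =>
          indicator_nonneg (fun _ _ => zero_le_one) ω
        have h2 := sum_le_hasSum s (fun i _ => hnn i) h1
        have h3 : 0 ≤ ∑ i ∈ s, (A i).indicator (fun _ => (1 : ℝ)) ω :=
          Finset.sum_nonneg fun i _ => hnn i
        have h4 := abs_le.1 (abs_indicator_one_le (⋃ i, A i) ω)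
        rw [abs_le]
        constructor <;> linarith [h4.2]
      · have hall : ∀ᵐ ω ∂P, ∀ s : Finset ℕ, ((U - ∑ i ∈ s, T i : orliczSpace hΦ P) : Ω →ₘ[P] ℝ) ω =
            (⋃ i, A i).indicator (fun _ => (1 : ℝ)) ω -
              ∑ i ∈ s, (A i).indicator (fun _ => (1 : ℝ)) ω := ae_all_iff.2 hae
        filter_upwards [hall] with ω h
        simp only [h]
        have h1 : Tendsto (fun s : Finset ℕ => ∑ i ∈ s, (A i).indicator (fun _ => (1 : ℝ)) ω) atTop
          (𝓝 ((⋃ i, A i).indicator (fun _ => (1 : ℝ)) ω)) :=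
          hasSum_indicator_iUnion_of_disjoint hdisj ω
        simpa using h1.const_sub ((⋃ i, A i).indicator (fun _ => (1 : ℝ)) ω)
    show Tendsto (fun s : Finset ℕ => ∑ i ∈ s, f (T i)) atTop (𝓝 (f U))
    have := hlim.const_sub (f U)
    simpa [map_sub, map_sum] using this

/-- Density of a linear functional bounded above on a modular ball, on bounded functions. -/
theorem exists_integrable_forall_bounded_eq_integral [IsFiniteMeasure P] {hΦ : IsOrliczFunction Φ}
    {c : ℝ} (hc : 0 < c) {ε : ℝ≥0∞} (hε : ε ≠ 0) {f : orliczSpace hΦ P →ₗ[ℝ] ℝ} {u : ℝ}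
    (hf : ∀ X ∈ orliczModularBall hΦ P c ε, f X ≤ u) :
    ∃ y : Ω → ℝ, Measurable y ∧ Integrable y P ∧ ∀ (X : orliczSpace hΦ P) (k : ℝ),
      (∀ᵐ ω ∂P, |(X : Ω →ₘ[P] ℝ) ω| ≤ k) → f X = ∫ ω, (X : Ω →ₘ[P] ℝ) ω * y ω ∂P := by
  classical
  set ν := orliczSignedMeasure hc hε hf with hν
  have hνA : ∀ A, MeasurableSet A → ν A = f (orliczClass hΦ P (A.indicator fun _ => (1 : ℝ))) :=
    fun A hA => if_pos hA
  -- The indicator of a null set is the zero class, which f kills.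
  have hac : ν ≪ᵥ P.toENNRealVectorMeasure := by
    refine VectorMeasure.AbsolutelyContinuous.mk fun A hA h0 => ?_
    rw [Measure.toENNRealVectorMeasure_apply_measurable hA] at h0
    rw [hνA A hA]
    have : orliczClass hΦ P (A.indicator fun _ => (1 : ℝ)) = 0 := by
      refine orliczSpace_ext ?_
      filter_upwards [coeFn_orliczClass_indicator (P := P) hΦ hA,
        coeFn_orliczSpace_zero (P := P) (hΦ := hΦ), measure_eq_zero_iff_ae_notMem.1 h0]
        with ω h1 h2 h3
      rw [h1, h2]; simp [h3]
    rw [this, map_zero]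
  set y := ν.rnDeriv P with hy
  have hyi : Integrable y P := SignedMeasure.integrable_rnDeriv ν P
  have hyA : ∀ A, MeasurableSet A →
      f (orliczClass hΦ P (A.indicator fun _ => (1 : ℝ))) = ∫ ω in A, y ω ∂P := by
    intro A hA
    rw [← hνA A hA, ← withDensityᵥ_apply hyi hA, hy, SignedMeasure.withDensityᵥ_rnDeriv_eq ν P hac]
  have hcls : ∀ g : SimpleFunc Ω ℝ,
      ((orliczClass hΦ P g : orliczSpace hΦ P) : Ω →ₘ[P] ℝ) =ᵐ[P] g := fun g => by
    obtain ⟨k, hk⟩ := g.exists_forall_norm_le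
    exact coeFn_orliczClass_of_bounded hΦ g.measurable.aestronglyMeasurable
      (Eventually.of_forall hk)
  have hgi : ∀ g : SimpleFunc Ω ℝ, Integrable (fun ω => g ω * y ω) P := fun g => by
    obtain ⟨k, hk⟩ := g.exists_forall_norm_le
    exact hyi.bdd_mul g.measurable.aestronglyMeasurable (Eventually.of_forall hk)
  have hsimple : ∀ g : SimpleFunc Ω ℝ, f (orliczClass hΦ P g) = ∫ ω, g ω * y ω ∂P := by
    intro g
    induction g using SimpleFunc.induction with
    | const r hA =>
      rename_i A
      have e : orliczClass hΦ P (SimpleFunc.piecewise A hA (SimpleFunc.const Ω r)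
          (SimpleFunc.const Ω 0)) = r • orliczClass hΦ P (A.indicator fun _ => (1 : ℝ)) := by
        refine orliczSpace_ext ?_
        filter_upwards [hcls (SimpleFunc.piecewise A hA (SimpleFunc.const Ω r)
          (SimpleFunc.const Ω 0)), coeFn_orliczSpace_smul r
            (orliczClass hΦ P (A.indicator fun _ => (1 : ℝ))),
          coeFn_orliczClass_indicator (P := P) hΦ hA] with ω h1 h2 h3
        rw [h1, h2, h3]
        by_cases hω : ω ∈ A <;> simp [hω]
      rw [e, map_smul, hyA A hA, smul_eq_mul, ← integral_const_mul, ← integral_indicator hA]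
      refine integral_congr_ae (Eventually.of_forall fun ω => ?_)
      by_cases hω : ω ∈ A <;> simp [hω]
    | add _ hg hh =>
      rename_i g h _
      have e : orliczClass hΦ P ((g + h : SimpleFunc Ω ℝ)) =
          orliczClass hΦ P g + orliczClass hΦ P h := by
        refine orliczSpace_ext ?_
        filter_upwards [hcls (g + h), hcls g, hcls h,
          coeFn_orliczSpace_add (orliczClass hΦ P g) (orliczClass hΦ P h)] with ω h1 h2 h3 h4
        rw [h1, h4, h2, h3]; simp
      rw [e, map_add, hg, hh, ← integral_add (hgi g) (hgi h)]
      refine integral_congr_ae (Eventually.of_forall fun ω => ?_)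
      simp [add_mul]
  refine ⟨y, SignedMeasure.measurable_rnDeriv ν P, hyi, fun X k hk => ?_⟩
  have hk : ∀ᵐ ω ∂P, ‖(X : Ω →ₘ[P] ℝ) ω‖ ≤ |k| := hk.mono fun ω h => h.trans (le_abs_self k)
  have hX : StronglyMeasurable (X : Ω →ₘ[P] ℝ) := AEEqFun.stronglyMeasurable _
  -- Uniformly bounded simple approximants: both sides of the formula pass to the limit, f by its
  -- continuity under bounded convergence and the integral by domination with |k| |y|.
  set g := hX.approxBounded |k| with hg
  have hgk : ∀ n ω, ‖g n ω‖ ≤ |k| := hX.norm_approxBounded_le (abs_nonneg k)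
  have hgX : ∀ᵐ ω ∂P, Tendsto (fun n => g n ω) atTop (𝓝 ((X : Ω →ₘ[P] ℝ) ω)) :=
    hX.tendsto_approxBounded_ae hk
  have hae : ∀ n, ((orliczClass hΦ P (g n) - X : orliczSpace hΦ P) : Ω →ₘ[P] ℝ) =ᵐ[P]
      fun ω => g n ω - (X : Ω →ₘ[P] ℝ) ω := fun n => by
    filter_upwards [hcls (g n), coeFn_orliczSpace_sub (orliczClass hΦ P (g n)) X] with ω h1 h2
    rw [h2, h1]
  have h1 : Tendsto (fun n => f (orliczClass hΦ P (g n) - X)) atTop (𝓝 0) := by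
    refine tendsto_of_bounded_of_le_on_modularBall hc hε hf (k := |k| + |k|) (fun n => ?_) ?_
    · filter_upwards [hae n, hk] with ω h1 h2
      rw [h1]
      exact (abs_sub _ _).trans (add_le_add (hgk n ω) h2)
    · filter_upwards [ae_all_iff.2 hae, hgX] with ω h1 h2
      simp only [h1]
      simpa using h2.sub_const ((X : Ω →ₘ[P] ℝ) ω)
  have h2 : Tendsto (fun n => f (orliczClass hΦ P (g n))) atTop (𝓝 (f X)) := by
    simpa using h1.add_const (f X)
  have h3 : Tendsto (fun n => ∫ ω, g n ω * y ω ∂P) atTop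
      (𝓝 (∫ ω, (X : Ω →ₘ[P] ℝ) ω * y ω ∂P)) := by
    refine tendsto_integral_of_dominated_convergence (fun ω => |k| * |y ω|)
      (fun n => (hgi (g n)).aestronglyMeasurable) (hyi.abs.const_mul _)
      (fun n => Eventually.of_forall fun ω => ?_) (hgX.mono fun ω h => h.mul_const _)
    rw [norm_mul]
    exact mul_le_mul_of_nonneg_right (hgk n ω) (norm_nonneg _)
  simp only [hsimple] at h2
  exact tendsto_nhds_unique h2 h3

end Density

/-! ### Membership of the density in L^Ψ. -/

section Conjugate

variable {Ω : Type*} [MeasurableSpace Ω] {P : Measure Ω} {Φ : ℝ → ℝ}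

/-- A measurable selection of `j ≤ n` maximizing `j * s ω - Φ j`. -/
theorem exists_measurable_argmax {s : Ω → ℝ} (hs : Measurable s) (n : ℕ) :
    ∃ J : Ω → ℕ, Measurable J ∧ (∀ ω, J ω ≤ n) ∧
      ∀ ω, ∀ j ≤ n, (j : ℝ) * s ω - Φ j ≤ (J ω : ℝ) * s ω - Φ (J ω) := by
  classical
  induction n with
  | zero => exact ⟨fun _ => 0, measurable_const, fun _ => le_rfl, fun ω j hj => by
      rw [Nat.le_zero.1 hj]⟩
  | succ n ih =>
    obtain ⟨J, hJ, hJn, hmax⟩ := ih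
    have hcast : Measurable fun j : ℕ => (j : ℝ) := measurable_from_nat
    have hΦJ : Measurable fun j : ℕ => Φ j := measurable_from_nat
    have hset : MeasurableSet {ω | (J ω : ℝ) * s ω - Φ (J ω) < ((n + 1 : ℕ) : ℝ) * s ω - Φ (n + 1 : ℕ)} :=
      measurableSet_lt (((hcast.comp hJ).mul hs).sub (hΦJ.comp hJ)) ((hs.const_mul _).sub_const _)
    refine ⟨fun ω => if (J ω : ℝ) * s ω - Φ (J ω) < ((n + 1 : ℕ) : ℝ) * s ω - Φ (n + 1 : ℕ)
      then n + 1 else J ω, Measurable.ite hset measurable_const hJ, fun ω => ?_, fun ω j hj => ?_⟩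
    · dsimp only
      split_ifs
      · exact le_rfl
      · exact (hJn ω).trans n.le_succ
    · dsimp only
      rcases Nat.le_succ_iff.1 hj with hj | rfl
      · split_ifs with h
        · exact (hmax ω j hj).trans h.le
        · exact hmax ω j hj
      · split_ifs with h
        · exact le_rfl
        · exact not_lt.1 h

/-- A function bounded as a functional on the bounded elements of a modular ball of `L^Φ` lies in
the conjugate Orlicz space. -/
theorem exists_orliczModular_conj_lt_top [IsFiniteMeasure P] (hΦ : IsOrliczFunction Φ)
    {c : ℝ} (hc : 0 < c) {ε : ℝ} (hε : 0 < ε) {u : ℝ} (hu : 0 < u) {y : Ω → ℝ} (hy : Measurable y) (hyi : Integrable y P)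
    (h : ∀ (g : Ω → ℝ) (k : ℝ), Measurable g → (∀ ω, |g ω| ≤ k) →
      orliczModular Φ P c g ≤ ENNReal.ofReal ε → ∫ ω, g ω * y ω ∂P ≤ u) :
    ∃ d : ℝ, 0 < d ∧ orliczModular (orliczConj Φ) P d y < ∞ := by
  -- Chosen so that c r d = u / (ε + m) below, which turns the bound u on the test integral into ∫ J
  -- s ≤ ε + m.
  set d : ℝ := u / (ε * c) with hd
  have hdpos : 0 < d := by positivity
  refine ⟨d, hdpos, ?_⟩
  set s : Ω → ℝ := fun ω => |y ω| / d with hsdef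
  have hs : Measurable s := by simp only [hsdef]; fun_prop
  have hs0 : ∀ ω, 0 ≤ s ω := fun ω => by positivity
  have hsi : Integrable s P := hyi.abs.div_const d
  choose J hJ hJn hmax using exists_measurable_argmax (Φ := Φ) hs
  have hcast : Measurable fun j : ℕ => (j : ℝ) := measurable_from_nat
  have hΦJ : Measurable fun j : ℕ => Φ j := measurable_from_nat
  have hJm : ∀ n, Measurable fun ω => (J n ω : ℝ) := fun n => hcast.comp (hJ n)
  have hJb : ∀ n ω, |(J n ω : ℝ)| ≤ n := fun n ω => by
    rw [Nat.abs_cast]; exact_mod_cast hJn n ω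
  have hJsi : ∀ n, Integrable (fun ω => (J n ω : ℝ) * s ω) P := fun n =>
    hsi.bdd_mul (hJm n).aestronglyMeasurable (Eventually.of_forall (hJb n))
  have hΦJi : ∀ n, Integrable (fun ω => Φ (J n ω)) P := fun n => by
    refine Integrable.of_bound ((hΦJ.comp (hJ n)).aestronglyMeasurable) (Φ n)
      (Eventually.of_forall fun ω => ?_)
    rw [Real.norm_of_nonneg (hΦ.nonneg (Nat.cast_nonneg _))]
    exact hΦ.mono (Nat.cast_nonneg _) (by exact_mod_cast hJn n ω)
  -- The test function is c r sign(y) J with m = E[Φ(J)] and r = ε / (ε + m); by convexity its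
  -- modular at scale c is at most r m ≤ ε, whatever the size of m.
  have hbound : ∀ n, ∫ ω, ((J n ω : ℝ) * s ω - Φ (J n ω)) ∂P ≤ ε := by
    intro n
    set m : ℝ := ∫ ω, Φ (J n ω) ∂P with hm
    have hm0 : 0 ≤ m := integral_nonneg fun ω => hΦ.nonneg (Nat.cast_nonneg _)
    have hmod : orliczModular Φ P 1 (fun ω => (J n ω : ℝ)) = ENNReal.ofReal m := by
      rw [hm, ofReal_integral_eq_lintegral_ofReal (hΦJi n)
        (Eventually.of_forall fun ω => hΦ.nonneg (Nat.cast_nonneg _))]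
      simp [orliczModular]
    set r : ℝ := ε / (ε + m) with hr
    have hrpos : 0 < r := by positivity
    have hr1 : r ≤ 1 := (div_le_one (by positivity)).2 (by linarith)
    have hsign : ∀ ω, |SignType.sign (y ω) * (J n ω : ℝ)| ≤ |(J n ω : ℝ)| := fun ω => by
      rw [abs_mul]
      refine mul_le_of_le_one_left (abs_nonneg _) ?_
      rcases lt_trichotomy (y ω) 0 with h | h | h <;> simp [h]
    have hsgm : Measurable fun ω => ((SignType.sign (y ω) : SignType) : ℝ) := by
      have e : (fun ω => ((SignType.sign (y ω) : SignType) : ℝ)) =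
          fun ω => if 0 < y ω then (1 : ℝ) else if y ω < 0 then -1 else 0 := by
        ext ω
        rcases lt_trichotomy (y ω) 0 with h | h | h
        · simp [h, h.not_gt]
        · simp [h]
        · simp [h]
      rw [e]
      exact Measurable.ite (measurableSet_lt measurable_const hy) measurable_const
        (Measurable.ite (measurableSet_lt hy measurable_const) measurable_const measurable_const)
    have key := h (fun ω => c * (r * (SignType.sign (y ω) * (J n ω : ℝ)))) (c * (r * n))
      (((hsgm.mul (hJm n)).const_mul r).const_mul c) (fun ω => by
        rw [abs_mul, abs_mul, abs_of_pos hc, abs_of_pos hrpos]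
        exact mul_le_mul_of_nonneg_left (mul_le_mul_of_nonneg_left
          ((hsign ω).trans (hJb n ω)) hrpos.le) hc.le) (by
        have e := orliczModular_mul (Φ := Φ) (P := P) 1 c hc
          (fun ω => r * (SignType.sign (y ω) * (J n ω : ℝ)))
        rw [mul_one] at e
        rw [e]
        refine (orliczModular_smul_le hΦ one_pos hrpos.le hr1 _).trans ?_
        calc _ ≤ ENNReal.ofReal r * ENNReal.ofReal m := by
              rw [← hmod]
              exact mul_le_mul_right (orliczModular_mono hΦ one_pos (Eventually.of_forall hsign)) _
          _ ≤ ENNReal.ofReal ε := by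
              rw [← ENNReal.ofReal_mul hrpos.le]
              refine ENNReal.ofReal_le_ofReal ?_
              rw [hr, div_mul_eq_mul_div, div_le_iff₀ (by positivity)]
              nlinarith)
    have e2 : ∀ ω, c * (r * (SignType.sign (y ω) * (J n ω : ℝ))) * y ω =
        c * r * d * ((J n ω : ℝ) * s ω) := fun ω => by
      have : |y ω| = SignType.sign (y ω) * y ω := (sign_mul_self (y ω)).symm
      simp only [hsdef, this]
      field_simp
    simp only [e2] at key
    rw [integral_const_mul] at key
    rw [integral_sub (hJsi n) (hΦJi n), ← hm]
    have e3 : c * r * d = u / (ε + m) := by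
      rw [hr, hd]; field_simp
    rw [e3, div_mul_eq_mul_div, div_le_iff₀ (by positivity)] at key
    have := le_of_mul_le_mul_left key hu
    linarith
  have hG0 : ∀ n ω, 0 ≤ (J n ω : ℝ) * s ω - Φ (J n ω) := fun n ω => by
    simpa [hΦ.map_zero] using hmax n ω 0 (Nat.zero_le n)
  set G : ℕ → Ω → ℝ≥0∞ := fun n ω => ENNReal.ofReal ((J n ω : ℝ) * s ω - Φ (J n ω)) with hG
  have hGm : ∀ n, Measurable (G n) := fun n =>
    (((hJm n).mul hs).sub (hΦJ.comp (hJ n))).ennreal_ofReal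
  have hGle : ∀ n, ∫⁻ ω, G n ω ∂P ≤ ENNReal.ofReal ε := fun n => by
    exact (ofReal_integral_eq_lintegral_ofReal ((hJsi n).sub (hΦJi n))
      (Eventually.of_forall (hG0 n))).ge.trans (ENNReal.ofReal_le_ofReal (hbound n))
  -- Replacing t by its integer part costs at most s in t s - Φ t, since Φ only decreases. The
  -- supremum defining Ψ(s) may thus run over integers up to the error s, which is integrable
  -- because y is; Fatou handles the rest.
  have hpt : ∀ ω, ENNReal.ofReal (orliczConj Φ (s ω)) ≤
      ENNReal.ofReal (s ω) + liminf (fun n => G n ω) atTop := by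
    intro ω
    have hterm : ∀ t : ℝ, 0 ≤ t → ENNReal.ofReal (t * s ω - Φ t) ≤
        ENNReal.ofReal (s ω) + liminf (fun n => G n ω) atTop := by
      intro t ht
      have h1 : ENNReal.ofReal ((⌊t⌋₊ : ℝ) * s ω - Φ ⌊t⌋₊) ≤ liminf (fun n => G n ω) atTop := by
        refine le_liminf_of_le (by isBoundedDefault) ?_
        filter_upwards [eventually_ge_atTop ⌊t⌋₊] with n hn
        exact ENNReal.ofReal_le_ofReal (hmax n ω _ hn)
      refine le_trans ?_ (add_le_add_right h1 _)
      refine le_trans (ENNReal.ofReal_le_ofReal ?_) ENNReal.ofReal_add_le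
      have h2 : Φ ⌊t⌋₊ ≤ Φ t := hΦ.mono (Nat.cast_nonneg _) (Nat.floor_le ht)
      have h3 : t * s ω ≤ (⌊t⌋₊ + 1) * s ω :=
        mul_le_mul_of_nonneg_right (Nat.lt_floor_add_one t).le (hs0 ω)
      linarith
    by_cases htop : ENNReal.ofReal (s ω) + liminf (fun n => G n ω) atTop = ∞
    · rw [htop]; exact le_top
    · rw [ENNReal.ofReal_le_iff_le_toReal htop]
      refine csSup_le ⟨_, 0, mem_Ici.2 le_rfl, rfl⟩ ?_
      rintro _ ⟨t, ht, rfl⟩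
      exact (ENNReal.ofReal_le_iff_le_toReal htop).1 (hterm t ht)
  calc orliczModular (orliczConj Φ) P d y
      ≤ ∫⁻ ω, (ENNReal.ofReal (s ω) + liminf (fun n => G n ω) atTop) ∂P := lintegral_mono hpt
    _ = ∫⁻ ω, ENNReal.ofReal (s ω) ∂P + ∫⁻ ω, liminf (fun n => G n ω) atTop ∂P :=
        lintegral_add_left hs.ennreal_ofReal _
    _ ≤ ∫⁻ ω, ENNReal.ofReal (s ω) ∂P + ENNReal.ofReal ε := by
        gcongr
        refine (lintegral_liminf_le hGm).trans ?_
        exact liminf_le_of_le (by isBoundedDefault) fun b hb => by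
          obtain ⟨n, hn⟩ := hb.exists
          exact hn.trans (hGle n)
    _ < ∞ := by
        refine ENNReal.add_lt_top.2 ⟨?_, ENNReal.ofReal_lt_top⟩
        rw [← ofReal_integral_eq_lintegral_ofReal hsi (Eventually.of_forall hs0)]
        exact ENNReal.ofReal_lt_top

/-! ### Strict separation by an element of L^Ψ. -/

/-- A convex set in `L^Φ` avoiding a modular ball of twice the scale at which its elements have
finite modular is strictly separated from `0` by an element of `L^Ψ`. -/
theorem exists_pairing_ge_of_forall_lt_orliczModular [IsFiniteMeasure P] (hΦ : IsOrliczFunction Φ)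
    (hlim : Tendsto (fun t : ℝ => Φ t / t) atTop atTop) {D : Set (orliczSpace hΦ P)}
    (hD : Convex ℝ D) {a : ℝ} (ha : 0 < a)
    (hfin : ∀ X ∈ D, orliczModular Φ P a (X : Ω →ₘ[P] ℝ) < ∞) {ε : ℝ} (hε : 0 < ε)
    (hlt : ∀ X ∈ D, ENNReal.ofReal ε < orliczModular Φ P (2 * a) (X : Ω →ₘ[P] ℝ)) :
    ∃ (Y : orliczSpace (hΦ.conj hlim) P) (δ : ℝ), 0 < δ ∧
      ∀ X ∈ D, δ ≤ orliczPairing hΦ hlim P X Y := by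
  have h2a : 0 < 2 * a := by positivity
  have hε0 : ENNReal.ofReal ε ≠ 0 := (ENNReal.ofReal_pos.2 hε).ne'
  obtain ⟨f, u, hu, hfB, hfD⟩ := exists_linearMap_separating_of_absorbent
    (balanced_orliczModularBall hΦ h2a (ENNReal.ofReal ε) (P := P))
    (convex_orliczModularBall hΦ h2a (ENNReal.ofReal ε))
    (absorbent_orliczModularBall hΦ h2a hε0) hD
    (Set.disjoint_left.2 fun X hX hXD => (hlt X hXD).not_ge hX)
  obtain ⟨y, hy, hyi, hrep⟩ := exists_integrable_forall_bounded_eq_integral h2a hε0 hfB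
  obtain ⟨d, hd, hyd⟩ := exists_orliczModular_conj_lt_top hΦ h2a hε hu hy hyi (by
    intro g k hg hk hmod
    have e := coeFn_orliczClass_of_bounded (P := P) hΦ hg.aestronglyMeasurable
      (Eventually.of_forall hk)
    have h1 := hfB (orliczClass hΦ P g) ((orliczModular_congr e).le.trans hmod)
    rw [hrep (orliczClass hΦ P g) k (e.mono fun ω h => by rw [h]; exact hk ω)] at h1
    refine le_trans (le_of_eq (integral_congr_ae (e.mono fun ω h => ?_))) h1
    simp only [h])
  set Y := orliczClass (hΦ.conj hlim) P y
  have hY : ((Y : orliczSpace (hΦ.conj hlim) P) : Ω →ₘ[P] ℝ) =ᵐ[P] y :=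
    coeFn_orliczClass (hΦ.conj hlim) hy.aestronglyMeasurable hd hyd
  refine ⟨Y, u / 2, by positivity, fun X hX => ?_⟩
  set x : Ω → ℝ := fun ω => (X : Ω →ₘ[P] ℝ) ω with hx
  have hxm : Measurable x := (AEEqFun.stronglyMeasurable _).measurable
  have hset : ∀ k : ℕ, MeasurableSet {ω | |x ω| ≤ k} := fun k =>
    measurableSet_le hxm.abs measurable_const
  set lo : ℕ → Ω → ℝ := fun k => {ω | |x ω| ≤ k}.indicator x with hlo
  have hlo_abs : ∀ k ω, |lo k ω| ≤ |x ω| := fun k ω => by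
    by_cases h : |x ω| ≤ k <;> simp [hlo, h]
  have hlo_bd : ∀ (k : ℕ) ω, |lo k ω| ≤ k := fun k ω => by
    by_cases h : |x ω| ≤ k <;> simp [hlo, h]
  have hlo_m : ∀ k, Measurable (lo k) := fun k => hxm.indicator (hset k)
  have hlo_eq : ∀ ω, ∀ᶠ k in atTop, lo k ω = x ω := fun ω => by
    filter_upwards [eventually_ge_atTop ⌈|x ω|⌉₊] with k hk
    exact indicator_of_mem (s := {ω | |x ω| ≤ k}) (Nat.ceil_le.1 hk) x
  have hlo_lim : ∀ ω, Tendsto (fun k => lo k ω) atTop (𝓝 (x ω)) := fun ω =>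
    tendsto_const_nhds.congr' ((hlo_eq ω).mono fun k h => h.symm)
  have hae : ∀ k, ((orliczClass hΦ P (lo k) : orliczSpace hΦ P) : Ω →ₘ[P] ℝ) =ᵐ[P] lo k := fun k =>
    coeFn_orliczClass_of_bounded hΦ (hlo_m k).aestronglyMeasurable
      (Eventually.of_forall (hlo_bd k))
  have htail : Tendsto (fun k => orliczModular Φ P a (fun ω => x ω - lo k ω)) atTop (𝓝 0) := by
    refine tendsto_orliczModular_zero hΦ ha (b := x) (fun k => (hxm.sub (hlo_m k)).aemeasurable)
      (hfin X hX) (fun k => Eventually.of_forall fun ω => ?_) (Eventually.of_forall fun ω => ?_)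
    · by_cases h : |x ω| ≤ k <;> simp [hlo, h]
    · simpa using (hlo_lim ω).const_sub (x ω)
  have hev : ∀ᶠ k in atTop, u / 2 ≤ ∫ ω, lo k ω * y ω ∂P := by
    filter_upwards [htail.eventually (gt_mem_nhds (pos_iff_ne_zero.2 hε0))] with k hk
    -- Doubling the tail and doubling the scale cancel, so the modular is that of the tail at scale
    -- a, which tends to 0. Hence f of the tail is at most u / 2, leaving at least u / 2 for the
    -- truncation.
    have h1 : (2 : ℝ) • (X - orliczClass hΦ P (lo k)) ∈
        orliczModularBall hΦ P (2 * a) (ENNReal.ofReal ε) := by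
      refine le_trans (le_of_eq ?_) hk.le
      rw [← orliczModular_mul a 2 two_pos]
      refine orliczModular_congr ?_
      filter_upwards [coeFn_orliczSpace_smul (2 : ℝ) (X - orliczClass hΦ P (lo k)),
        coeFn_orliczSpace_sub X (orliczClass hΦ P (lo k)), hae k] with ω h1 h2 h3
      rw [h1, h2, h3]
    have h2 := hfB _ h1
    rw [map_smul, map_sub, smul_eq_mul] at h2
    have h3 := hfD X hX
    have h4 := hrep (orliczClass hΦ P (lo k)) k ((hae k).mono fun ω h => by
      rw [h]; exact hlo_bd k ω)
    have h5 : ∫ ω, lo k ω * y ω ∂P = f (orliczClass hΦ P (lo k)) := by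
      rw [h4]
      exact integral_congr_ae ((hae k).mono fun ω h => by simp only [h])
    rw [h5]
    linarith
  have hxy : Integrable (fun ω => x ω * y ω) P :=
    (integrable_mul_orlicz hΦ hlim X Y).congr (hY.mono fun ω h => by simp only [h, hx])
  have hint : Tendsto (fun k => ∫ ω, lo k ω * y ω ∂P) atTop (𝓝 (∫ ω, x ω * y ω ∂P)) := by
    refine tendsto_integral_of_dominated_convergence (fun ω => |x ω * y ω|)
      (fun k => ((hlo_m k).mul hy).aestronglyMeasurable) hxy.abs
      (fun k => Eventually.of_forall fun ω => ?_)
      (Eventually.of_forall fun ω => (hlo_lim ω).mul_const _)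
    rw [Real.norm_eq_abs, abs_mul, abs_mul]
    exact mul_le_mul_of_nonneg_right (hlo_abs k ω) (abs_nonneg _)
  have hpair : orliczPairing hΦ hlim P X Y = ∫ ω, x ω * y ω ∂P :=
    integral_congr_ae (hY.mono fun ω h => by simp only [h, hx])
  rw [hpair]
  exact ge_of_tendsto hint hev

end Conjugate

/-! ### Order closure against weak closure. -/

section OrderClosure

variable {Ω : Type*} [MeasurableSpace Ω] {P : Measure Ω} {Φ : ℝ → ℝ}

theorem continuous_orliczPairing (hΦ : IsOrliczFunction Φ)
    (hlim : Tendsto (fun t : ℝ => Φ t / t) atTop atTop) (Y : orliczSpace (hΦ.conj hlim) P) :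
    Continuous[orliczWeakTopology hΦ hlim P, inferInstance]
      (fun X : orliczSpace hΦ P => orliczPairing hΦ hlim P X Y) :=
  WeakBilin.eval_continuous (orliczPairing hΦ hlim P) Y

/-- Weak convergence is tested on each Y ∈ L^Ψ, where dominated convergence applies with the
integrable bound |Z Y|. -/
theorem OrderConverges.tendsto_weak {hΦ : IsOrliczFunction Φ}
    (hlim : Tendsto (fun t : ℝ => Φ t / t) atTop atTop) {X : ℕ → orliczSpace hΦ P}
    {L : orliczSpace hΦ P} (h : OrderConverges X L) :
    Tendsto X atTop (@nhds _ (orliczWeakTopology hΦ hlim P) L) := by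
  obtain ⟨hae, Z, hZ⟩ := h
  have hnhds : @nhds _ (orliczWeakTopology hΦ hlim P) L =
      comap (fun X Y => orliczPairing hΦ hlim P X Y) (𝓝 fun Y => orliczPairing hΦ hlim P L Y) :=
    nhds_induced _ L
  rw [hnhds, tendsto_comap_iff, tendsto_pi_nhds]
  intro Y
  show Tendsto (fun n => ∫ ω, (X n : Ω →ₘ[P] ℝ) ω * (Y : Ω →ₘ[P] ℝ) ω ∂P) atTop
    (𝓝 (∫ ω, (L : Ω →ₘ[P] ℝ) ω * (Y : Ω →ₘ[P] ℝ) ω ∂P))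
  refine tendsto_integral_of_dominated_convergence
    (fun ω => |(Z : Ω →ₘ[P] ℝ) ω * (Y : Ω →ₘ[P] ℝ) ω|)
    (fun n => (integrable_mul_orlicz hΦ hlim (X n) Y).aestronglyMeasurable)
    (integrable_mul_orlicz hΦ hlim Z Y).abs (fun n => ?_) (hae.mono fun ω h => h.mul_const _)
  filter_upwards [hZ n] with ω h
  rw [Real.norm_eq_abs, abs_mul, abs_mul]
  exact mul_le_mul_of_nonneg_right (h.trans (le_abs_self _)) (abs_nonneg _)

theorem orderClosure_subset_weakClosure {hΦ : IsOrliczFunction Φ}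
    (hlim : Tendsto (fun t : ℝ => Φ t / t) atTop atTop) (C : Set (orliczSpace hΦ P)) :
    orderClosure C ⊆ closure[orliczWeakTopology hΦ hlim P] C := by
  rintro L ⟨X, hX, hXL⟩
  let := orliczWeakTopology hΦ hlim P
  exact mem_closure_of_tendsto (hXL.tendsto_weak hlim) (Eventually.of_forall hX)

theorem subset_orderClosure {hΦ : IsOrliczFunction Φ} (C : Set (orliczSpace hΦ P)) :
    C ⊆ orderClosure C := by
  intro L hL
  obtain ⟨c, hc, hLc⟩ := exists_orliczModular_le_one L
  have habs : ((orliczClass hΦ P (fun ω => |(L : Ω →ₘ[P] ℝ) ω|) : orliczSpace hΦ P) : Ω →ₘ[P] ℝ)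
      =ᵐ[P] fun ω => |(L : Ω →ₘ[P] ℝ) ω| := by
    refine coeFn_orliczClass hΦ (L : Ω →ₘ[P] ℝ).aestronglyMeasurable.norm hc ?_
    refine lt_of_le_of_lt ?_ (hLc.trans_lt ENNReal.one_lt_top)
    exact orliczModular_mono hΦ hc (Eventually.of_forall fun ω => by rw [abs_abs])
  exact ⟨fun _ => L, fun _ => hL, Eventually.of_forall fun ω => tendsto_const_nhds,
    orliczClass hΦ P (fun ω => |(L : Ω →ₘ[P] ℝ) ω|), fun _ => habs.mono fun ω h => h.ge⟩

/-- Luxemburg bounded sets have, after a translation, modular at most one at a common scale. -/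
theorem IsLuxemburgBounded.exists_orliczModular_sub_lt_top {hΦ : IsOrliczFunction Φ}
    {C : Set (orliczSpace hΦ P)} (hC : IsLuxemburgBounded C) (L : orliczSpace hΦ P) :
    ∃ a : ℝ, 0 < a ∧ ∀ X ∈ C,
      orliczModular Φ P a ((X - L : orliczSpace hΦ P) : Ω →ₘ[P] ℝ) < ∞ := by
  obtain ⟨M, hM⟩ := hC
  obtain ⟨b, hb, hLb⟩ := exists_orliczModular_le_one L
  set m : ℝ := |M| + 1 + b with hm
  have hmpos : 0 < m := by positivity
  refine ⟨2 * m, by positivity, fun X hX => ?_⟩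
  have hXm : orliczModular Φ P m (X : Ω →ₘ[P] ℝ) ≤ 1 := by
    -- A strict bound is needed to extract an admissible scale from the infimum; the absolute value
    -- covers negative M.
    have h1 : luxemburgNorm Φ P (X : Ω →ₘ[P] ℝ) < ENNReal.ofReal (|M| + 1) :=
      (hM X hX).trans_lt ((ENNReal.ofReal_lt_ofReal_iff (by positivity)).2
        (by linarith [le_abs_self M]))
    simp only [luxemburgNorm, iInf_lt_iff] at h1
    obtain ⟨c, hc, hXc, hcM⟩ := h1
    have hcM' : c < |M| + 1 := (ENNReal.ofReal_lt_ofReal_iff (by positivity)).1 hcM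
    exact (antitone_orliczModular hΦ hc (by linarith) _).trans hXc
  have hLm : orliczModular Φ P m (L : Ω →ₘ[P] ℝ) ≤ 1 :=
    (antitone_orliczModular hΦ hb (by linarith [abs_nonneg M]) _).trans hLb
  have hLm' : orliczModular Φ P m (fun ω => -(L : Ω →ₘ[P] ℝ) ω) ≤ 1 := by
    refine le_trans (le_of_eq ?_) hLm
    simp [orliczModular]
  -- Writing X - L as twice a midpoint lets convexity apply at scale m, whence the scale 2 m.
  have e : ((X - L : orliczSpace hΦ P) : Ω →ₘ[P] ℝ) =ᵐ[P] fun ω =>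
      2 * ((1 / 2) * (X : Ω →ₘ[P] ℝ) ω + (1 / 2) * (-(L : Ω →ₘ[P] ℝ) ω)) := by
    filter_upwards [coeFn_orliczSpace_sub X L] with ω h
    rw [h]; ring
  rw [orliczModular_congr e, orliczModular_mul m 2 two_pos]
  refine (orliczModular_convexComb_le hΦ hmpos
    (X : Ω →ₘ[P] ℝ).aestronglyMeasurable.aemeasurable (by norm_num) (by norm_num)
    (by norm_num)).trans_lt (ENNReal.add_lt_top.2 ⟨?_, ?_⟩)
  · exact ENNReal.mul_lt_top ENNReal.ofReal_lt_top (hXm.trans_lt ENNReal.one_lt_top)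
  · exact ENNReal.mul_lt_top ENNReal.ofReal_lt_top (hLm'.trans_lt ENNReal.one_lt_top)

/-- Summability of the modulars implies order convergence. -/
theorem orderConverges_of_tsum_orliczModular_lt_top {hΦ : IsOrliczFunction Φ}
    (hpos : ∀ t : ℝ, 0 < t → 0 < Φ t) (hlim : Tendsto (fun t : ℝ => Φ t / t) atTop atTop)
    {a : ℝ} (ha : 0 < a) {X : ℕ → orliczSpace hΦ P} {L : orliczSpace hΦ P}
    (h : ∑' n, orliczModular Φ P a ((X n - L : orliczSpace hΦ P) : Ω →ₘ[P] ℝ) < ∞) :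
    OrderConverges X L := by
  set W : ℕ → Ω → ℝ := fun n ω => |((X n - L : orliczSpace hΦ P) : Ω →ₘ[P] ℝ) ω| with hW
  have hWm : ∀ n, Measurable (W n) := fun n => (AEEqFun.stronglyMeasurable _).measurable.abs
  have hW0 : ∀ n ω, 0 ≤ W n ω := fun n ω => abs_nonneg _
  have hΦm : ∀ n, AEMeasurable (fun ω => ENNReal.ofReal (Φ (W n ω / a))) P := fun n =>
    (hΦ.aemeasurable_comp _ ha).ennreal_ofReal
  set S : Ω → ℝ≥0∞ := fun ω => ∑' n, ENNReal.ofReal (Φ (W n ω / a)) with hS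
  have hSint : ∫⁻ ω, S ω ∂P < ∞ := by
    rw [lintegral_tsum hΦm]
    exact h
  have hSfin : ∀ᵐ ω ∂P, S ω < ∞ :=
    ae_lt_top' (AEMeasurable.tsum hΦm) hSint.ne
  have hsub : ∀ᵐ ω ∂P, ∀ n, W n ω = |(X n : Ω →ₘ[P] ℝ) ω - (L : Ω →ₘ[P] ℝ) ω| :=
    ae_all_iff.2 fun n => (coeFn_orliczSpace_sub (X n) L).mono fun ω h => by simp only [hW, h]
  have hle : ∀ n ω, ENNReal.ofReal (Φ (W n ω / a)) ≤ S ω := fun n ω =>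
    ENNReal.le_tsum (f := fun n => ENNReal.ofReal (Φ (W n ω / a))) n
  -- For t > 1, Φ t ≥ Φ t / t, which eventually exceeds S ω, while each Φ (W n ω / a) is at most S
  -- ω. Boundedness is needed because a real supremum of an unbounded family is 0 by default.
  have hbdd : ∀ ω, S ω < ∞ → BddAbove (range fun n => W n ω) := by
    intro ω hω
    obtain ⟨T, hT⟩ := (hlim.eventually_gt_atTop (S ω).toReal).exists_forall_of_atTop
    refine ⟨a * max T 1, ?_⟩
    rintro _ ⟨n, rfl⟩
    by_contra hcon
    have hcon : a * max T 1 < W n ω := not_le.1 hcon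
    have h1 : max T 1 < W n ω / a := by rwa [lt_div_iff₀ ha, mul_comm]
    have h2 := hT _ ((le_max_left T 1).trans h1.le)
    have h3 : 1 < W n ω / a := (le_max_right T 1).trans_lt h1
    have h4 : Φ (W n ω / a) / (W n ω / a) ≤ Φ (W n ω / a) :=
      div_le_self (hΦ.nonneg (by linarith)) h3.le
    have h5 := (ENNReal.ofReal_le_iff_le_toReal hω.ne).1 (hle n ω)
    linarith
  have htend : ∀ ω, S ω < ∞ → Tendsto (fun n => W n ω) atTop (𝓝 0) := by
    intro ω hω
    have h1 : Tendsto (fun n => ENNReal.ofReal (Φ (W n ω / a))) atTop (𝓝 0) :=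
      ENNReal.tendsto_atTop_zero_of_tsum_ne_top hω.ne
    rw [Metric.tendsto_nhds]
    intro δ hδ
    filter_upwards [h1.eventually (gt_mem_nhds (ENNReal.ofReal_pos.2 (hpos (δ / a)
      (by positivity))))] with n hn
    rw [Real.dist_eq, sub_zero, abs_of_nonneg (hW0 n ω)]
    by_contra hcon
    exact hn.not_ge (ENNReal.ofReal_le_ofReal (hΦ.mono (by positivity)
      (by have := not_lt.1 hcon; gcongr)))
  refine ⟨?_, ?_⟩
  · filter_upwards [hSfin, hsub] with ω h1 h2
    have h3 := htend ω h1
    simp only [h2] at h3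
    exact tendsto_iff_dist_tendsto_zero.2 h3
  set V : Ω → ℝ := fun ω => ⨆ n, W n ω with hV
  have hVm : Measurable V := Measurable.iSup hWm
  -- Where V > 0, some W n exceeds V / 2, so Φ (V / 2a) ≤ Φ (W n / a) ≤ S; halving avoids having to
  -- attain the supremum.
  have hVmod : orliczModular Φ P (2 * a) V < ∞ := by
    refine lt_of_le_of_lt (lintegral_mono_ae ?_) hSint
    filter_upwards [hSfin] with ω hω
    have hV0 : 0 ≤ V ω := Real.iSup_nonneg fun n => hW0 n ω
    rw [abs_of_nonneg hV0]
    rcases hV0.eq_or_lt with h0 | h0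
    · rw [← h0]; simp [hΦ.map_zero]
    · obtain ⟨n, hn⟩ := exists_lt_of_lt_ciSup (show V ω / 2 < ⨆ n, W n ω from half_lt_self h0)
      refine le_trans (ENNReal.ofReal_le_ofReal (hΦ.mono (by positivity) ?_)) (hle n ω)
      rw [← div_div]
      gcongr
  have hVc := coeFn_orliczClass hΦ hVm.aestronglyMeasurable (by positivity : 0 < 2 * a) hVmod
  obtain ⟨c, hc, hLc⟩ := exists_orliczModular_le_one L
  have hLabs := coeFn_orliczClass hΦ (g := fun ω => |(L : Ω →ₘ[P] ℝ) ω|)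
    (L : Ω →ₘ[P] ℝ).aestronglyMeasurable.norm hc
    ((orliczModular_mono hΦ hc (Eventually.of_forall fun ω => by rw [abs_abs])).trans_lt
      (hLc.trans_lt ENNReal.one_lt_top))
  refine ⟨orliczClass hΦ P (fun ω => |(L : Ω →ₘ[P] ℝ) ω|) + orliczClass hΦ P V, fun n => ?_⟩
  filter_upwards [coeFn_orliczSpace_add (orliczClass hΦ P (fun ω => |(L : Ω →ₘ[P] ℝ) ω|))
    (orliczClass hΦ P V), hVc, hLabs, hSfin, hsub] with ω h1 h2 h3 h4 h5
  rw [h1, h2, h3]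
  have h6 : W n ω ≤ V ω := le_ciSup (hbdd ω h4) n
  rw [h5 n] at h6
  calc |(X n : Ω →ₘ[P] ℝ) ω|
      = |(L : Ω →ₘ[P] ℝ) ω + ((X n : Ω →ₘ[P] ℝ) ω - (L : Ω →ₘ[P] ℝ) ω)| := by ring_nf
    _ ≤ _ := (abs_add_le _ _).trans (by gcongr)

theorem weakClosure_subset_orderClosure [IsFiniteMeasure P] {hΦ : IsOrliczFunction Φ}
    (hpos : ∀ t : ℝ, 0 < t → 0 < Φ t) (hlim : Tendsto (fun t : ℝ => Φ t / t) atTop atTop)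
    {C : Set (orliczSpace hΦ P)} (hconv : Convex ℝ C) (hbdd : IsLuxemburgBounded C) :
    closure[orliczWeakTopology hΦ hlim P] C ⊆ orderClosure C := by
  intro L hL
  obtain ⟨a, ha, hfin⟩ := hbdd.exists_orliczModular_sub_lt_top L
  have key : ∀ ε : ℝ, 0 < ε → ∃ X ∈ C,
      orliczModular Φ P (2 * a) ((X - L : orliczSpace hΦ P) : Ω →ₘ[P] ℝ) ≤ ENNReal.ofReal ε := by
    intro ε hε
    by_contra! hcon
    obtain ⟨Y, δ, hδ, hY⟩ := exists_pairing_ge_of_forall_lt_orliczModular hΦ hlim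
      (D := (fun X => X - L) '' C)
      (by simpa only [neg_add_eq_sub] using hconv.translate (-L)) ha
      (by rintro _ ⟨X, hX, rfl⟩; exact hfin X hX) hε
      (by rintro _ ⟨X, hX, rfl⟩; exact hcon X hX)
    let := orliczWeakTopology hΦ hlim P
    -- A weakly closed half-space containing C but, as δ > 0, not L.
    have hclosed : IsClosed {X : orliczSpace hΦ P |
        δ + orliczPairing hΦ hlim P L Y ≤ orliczPairing hΦ hlim P X Y} :=
      isClosed_le continuous_const (continuous_orliczPairing hΦ hlim Y)
    have hmem := closure_minimal (fun X hX => by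
      have := hY _ ⟨X, hX, rfl⟩
      rw [map_sub, LinearMap.sub_apply] at this
      show δ + orliczPairing hΦ hlim P L Y ≤ orliczPairing hΦ hlim P X Y
      linarith) hclosed hL
    have : δ + orliczPairing hΦ hlim P L Y ≤ orliczPairing hΦ hlim P L Y := hmem
    linarith
  choose X hXC hX using fun n : ℕ => key ((1 / 2) ^ n) (by positivity)
  refine ⟨X, hXC, orderConverges_of_tsum_orliczModular_lt_top hpos hlim
    (by positivity : 0 < 2 * a) ?_⟩
  refine (ENNReal.tsum_le_tsum hX).trans_lt ?_
  rw [← ENNReal.ofReal_tsum_of_nonneg (fun n => by positivity) summable_geometric_two]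
  exact ENNReal.ofReal_lt_top

end OrderClosure

theorem theorem3p4 {Ω : Type*} [MeasurableSpace Ω] (P : Measure Ω) [IsProbabilityMeasure P]
    (hP : IsNonatomic P) (Φ : ℝ → ℝ) (hΦ : IsOrliczFunction Φ)
    (hpos : ∀ t : ℝ, 0 < t → 0 < Φ t)
    (hlim : Tendsto (fun t : ℝ => Φ t / t) atTop atTop)
    (C : Set (orliczSpace hΦ P)) (hconv : Convex ℝ C) (hbdd : IsLuxemburgBounded C) :
    orderClosure C = closure[orliczWeakTopology hΦ hlim P] C ∧
      IsOrderClosed (orderClosure C) ∧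
      (IsOrderClosed C ↔ IsClosed[orliczWeakTopology hΦ hlim P] C) := by
  have heq : orderClosure C = closure[orliczWeakTopology hΦ hlim P] C :=
    (orderClosure_subset_weakClosure hlim C).antisymm
      (weakClosure_subset_orderClosure hpos hlim hconv hbdd)
  refine ⟨heq, (subset_orderClosure _).antisymm ?_, ?_⟩
  -- Order limits of points of the order closure lie in the weak closure of a set that is already
  -- weakly closed.
  · refine (orderClosure_subset_weakClosure hlim _).trans ?_
    rw [heq]
    let := orliczWeakTopology hΦ hlim P
    exact closure_closure.le
  · rw [IsOrderClosed, heq]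
    let := orliczWeakTopology hΦ hlim P
    exact eq_comm.trans closure_eq_iff_isClosed
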